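/- For each sample size $n$ let $X_p$ be a real $n\times p$ design matrix of full column rank and let $X_i$ be an $n\times i$ submatrix of $X_p$ formed by $i$ of its columns, where $i=i(n)\le p=p(n)\le n$. For $j\in\{i,p\}$ let $H_j=X_j(X_j'X_j)^{-1}X_j'$. The reduced model $M_i$ is $\mathbf y\sim N(X_i\alpha_i,\sigma_i^2I_n)$ and the full model $M_p$ is $\mathbf y\sim N(X_p\beta_p,\sigma_p^2I_n)$. The Bayes factor of $M_p$ versus $M_i$ for intrinsic priors is $$B_{pi}(\mathbf y)=\frac2\pi(p+1)^{(p-i)/2}\int_0^{\pi/2}\frac{\sin^{p-i}\varphi\,\bigl(n+(p+1)\sin^2\varphi\bigr)^{(n-p)/2}}{\bigl(n\mathcal B_{ip}+(p+1)\sin^2\varphi\bigr)^{(n-i)/2}}\,d\varphi,\qquad \mathcal B_{ip}=\frac{\mathbf y'(I_n-H_p)\mathbf y}{\mathbf y'(I_n-H_i)\mathbf y},$$ and the distance from $M_p$ to $M_i$ is $\delta_{pi}=\frac1{\sigma_p^2}\,\beta_p'\,\frac{X_p'(I_n-H_i)X_p}{n}\,\beta_p$. **Theorem.** Suppose that, as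 $n\to\infty$, $n/p\to r$ and $n/i\to s$ with $1<r<s<\infty$. 1. When sampling from $M_i$ (with any parameter sequence $(\alpha_i,\sigma_i)$, $\sigma_i>0$, indexed by $n$), $B_{pi}(\mathbf y)\to0$ in probability. 2. When sampling from $M_p$ (with any parameter sequence $(\beta_p,\sigma_p)$, $\sigma_p>0$, indexed by $n$) for which $\lim_{n\to\infty}\delta_{pi}$ exists in $[0,\infty]$, in probability $$B_{pi}(\mathbf y)\to\begin{cases}\infty,&\text{if }\lim_{n\to\infty}\delta_{pi}>\delta(r,s),\\ 0,&\text{if }\lim_{n\to\infty}\delta_{pi}<\delta(r,s),\end{cases}\qquad\text{where}\quad \delta(r,s)=\frac{r-1}{(r+1)^{\frac{s(r-1)}{r(s-1)}}-1}-1+\frac1s .$$ On the domain $1<r<s$ the function $\delta(r,s)$ has the following properties: $0\le\delta(r,s)\le\frac1{\log2}-1$; for each fixed $s>1$ it is strictly decreasing and convex in $r\in(1,s)$; it tends to $0$ as $r\to\infty$, uniformly in $s>r$ (that is, $\sup_{s>r}|\delta(r,s)|\to0$ as $r\to\infty$); and for each fixed $r>1$, $\lim_{s\to\infty}\delta(r,s)=\delta(r):=\frac{r-1}{(r+1)^{(r-1)/r}-1}-1$.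 -/

import Mathlib

open Filter Topology MeasureTheory ProbabilityTheory
open scoped Matrix

noncomputable section

/-- The hat matrix `H = X (X' X)⁻¹ X'` of a design matrix `X`. -/
def hatMatrix {n k : ℕ} (X : Matrix (Fin n) (Fin k) ℝ) : Matrix (Fin n) (Fin n) ℝ :=
  X * (Xᵀ * X)⁻¹ * Xᵀ

/-- The residual sum of squares `y' (I - H) y`. -/
def residualSS {n k : ℕ} (X : Matrix (Fin n) (Fin k) ℝ) (y : Fin n → ℝ) : ℝ :=
  y ⬝ᵥ ((1 - hatMatrix X) *ᵥ y)

/-- The ratio `RSS_p / RSS_i` for the full design `Xp` and the reduced design `Xi`. -/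
def rssRatio {n i p : ℕ} (Xi : Matrix (Fin n) (Fin i) ℝ) (Xp : Matrix (Fin n) (Fin p) ℝ)
    (y : Fin n → ℝ) : ℝ :=
  residualSS Xp y / residualSS Xi y

/-- The Bayes factor `B_{pi}(y)`, for intrinsic priors, of the full model with design `Xp`
versus the reduced model with design `Xi`. All powers are real powers. -/
def intrinsicBayesFactor {n i p : ℕ} (Xi : Matrix (Fin n) (Fin i) ℝ)
    (Xp : Matrix (Fin n) (Fin p) ℝ) (y : Fin n → ℝ) : ℝ :=
  2 / Real.pi * ((p : ℝ) + 1) ^ (((p : ℝ) - (i : ℝ)) / 2) *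
    ∫ φ in (0 : ℝ)..(Real.pi / 2),
      Real.sin φ ^ ((p : ℝ) - (i : ℝ)) *
          ((n : ℝ) + ((p : ℝ) + 1) * Real.sin φ ^ (2 : ℕ)) ^ (((n : ℝ) - (p : ℝ)) / 2) /
        ((n : ℝ) * rssRatio Xi Xp y + ((p : ℝ) + 1) * Real.sin φ ^ (2 : ℕ)) ^
          (((n : ℝ) - (i : ℝ)) / 2)

/-- The "distance" `δ_{pi} = σ⁻² β' (X_p' (I - H_i) X_p / n) β` from the full model with
parameters `β, σ` to the reduced model. -/
def modelDistance {n i p : ℕ} (Xi : Matrix (Fin n) (Fin i) ℝ) (Xp : Matrix (Fin n) (Fin p) ℝ)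
    (β : Fin p → ℝ) (σ : ℝ) : ℝ :=
  1 / σ ^ 2 * (β ⬝ᵥ (((1 / (n : ℝ)) • (Xpᵀ * (1 - hatMatrix Xi) * Xp)) *ᵥ β))

/-- The normal linear model `N(X b, σ² I_n)`: independent responses `y_j` with law
`N((X b)_j, σ²)`. -/
def linearModel {n k : ℕ} (X : Matrix (Fin n) (Fin k) ℝ) (b : Fin k → ℝ) (σ : ℝ) :
    Measure (Fin n → ℝ) :=
  Measure.pi fun j => gaussianReal ((X *ᵥ b) j) (σ ^ 2).toNNReal

/-- `Z_n → c` in probability, when the sample `y` of size `n` has law `μ n`. -/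
def TendstoInProb (μ : ∀ n : ℕ, Measure (Fin n → ℝ)) (Z : ∀ n : ℕ, (Fin n → ℝ) → ℝ)
    (c : ℝ) : Prop :=
  ∀ ε : ℝ, 0 < ε → Tendsto (fun n => μ n {y | ε ≤ |Z n y - c|}) atTop (𝓝 0)

/-- `Z_n → ∞` in probability, when the sample `y` of size `n` has law `μ n`. -/
def TendstoInProbAtTop (μ : ∀ n : ℕ, Measure (Fin n → ℝ))
    (Z : ∀ n : ℕ, (Fin n → ℝ) → ℝ) : Prop :=
  ∀ K : ℝ, Tendsto (fun n => μ n {y | Z n y ≤ K}) atTop (𝓝 0)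

/-- The boundary function
`δ(r, s) = (r - 1) / ((r + 1) ^ (s (r - 1) / (r (s - 1))) - 1) - 1 + 1 / s`. -/
def boundaryDelta (r s : ℝ) : ℝ :=
  (r - 1) / ((r + 1) ^ (s * (r - 1) / (r * (s - 1))) - 1) - 1 + 1 / s

/-- The limiting boundary function `δ(r) = (r - 1) / ((r + 1) ^ ((r - 1) / r) - 1) - 1`. -/
def boundaryDeltaLim (r : ℝ) : ℝ :=
  (r - 1) / ((r + 1) ^ ((r - 1) / r) - 1) - 1

end

/-! Put `w = n / ((p + 1) sin² φ)`, `κ = (n - p) / (n - i)`, and let `B` be the ratio of residual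
sums of squares. The integrand times `(p + 1) ^ ((p - i) / 2)` is exactly the power `(n - i) / 2` of
`(1 + w) ^ κ / (1 + B w)` (`bayesIntegrand_eq`). Here `w` runs over values at least `w₀ = n / (p +
1)`, attained at `φ = π / 2`. By concavity of `x ^ κ`, the base stays uniformly below 1 when `B`
exceeds the chord slope `((1 + w₀) ^ κ - 1) / w₀` by a fixed margin. If `B` falls short of it by a
fixed margin, the base exceeds 1 near `φ = π / 2`. As `n - i → ∞`, the Bayes factor tends to 0 or to
infinity accordingly, and the slope tends to `criticalRatio r s`.

Under the full model, Chebyshev's inequality puts the residual sums of squares, divided by `n σ²`,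
near `1 - 1/r` and `1 - 1/s + δ`. So `B` is near `(1 - 1/r) / (1 - 1/s + δ)`, and comparing this
with `criticalRatio` is comparing `δ` with `boundaryDelta` (`boundaryDelta_eq_criticalRatio`). The
reduced model is the full model with some coefficients zero, hence `δ = 0`, and `boundaryDelta_pos`
puts it on the side where the limit is 0.

For the boundary function, set `k = s / (s - 1)`: then `δ(r, s) = powerQuot k r - 1 / k`, and `r <
s` becomes `k (r - 1) < r`. Bernoulli's inequality gives positivity and reduces upper bounds to `k =
1`. Convexity is the hard point (`powerQuot_convexity_ineq`): Padé bounds settle `r ≤ 12`, Bernoulli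
the rest. Convexity and a finite limit at infinity make `powerQuot 1` decreasing; Bernoulli carries
this to `k > 1`. -/

/-! ### Padé bounds and elementary inequalities for `exp` and `log` -/

lemma nonneg_of_hasDerivAt_nonneg {f f' : ℝ → ℝ} (h0 : 0 ≤ f 0)
    (hd : ∀ x, 0 ≤ x → HasDerivAt f (f' x) x) (hn : ∀ x, 0 ≤ x → 0 ≤ f' x) :
    ∀ x, 0 ≤ x → 0 ≤ f x := by
  have hmono : MonotoneOn f (Set.Ici 0) := by
    refine monotoneOn_of_deriv_nonneg (convex_Ici 0)
      (fun x hx => (hd x hx).continuousAt.continuousWithinAt)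
      (fun x hx => ?_) (fun x hx => ?_)
    · rw [interior_Ici] at hx
      exact (hd x (le_of_lt hx)).differentiableAt.differentiableWithinAt
    · rw [interior_Ici] at hx
      rw [(hd x (le_of_lt hx)).deriv]
      exact hn x (le_of_lt hx)
  intro x hx
  exact h0.trans (hmono (Set.mem_Ici.2 le_rfl) hx hx)

/-- The [3/3] Padé approximant of `exp` with denominator cleared. The expression and its first three
derivatives vanish at 0, and the fourth derivative is `exp h * h ^ 3`. -/
lemma exp_pade_nonneg (h : ℝ) (hh : 0 ≤ h) :
    0 ≤ Real.exp h * (h ^ 3 - 12 * h ^ 2 + 60 * h - 120) + (h ^ 3 + 12 * h ^ 2 + 60 * h + 120) := by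
  have key : ∀ (a b c d a' b' c' d' x : ℝ),
      HasDerivAt (fun h : ℝ => Real.exp h * (a * h ^ 3 + b * h ^ 2 + c * h + d) +
        (a' * h ^ 3 + b' * h ^ 2 + c' * h + d'))
        (Real.exp x * (a * x ^ 3 + (b + 3 * a) * x ^ 2 + (c + 2 * b) * x + (d + c)) +
          (0 * x ^ 3 + 3 * a' * x ^ 2 + 2 * b' * x + c')) x := by
    intro a b c d a' b' c' d' x
    have hp : ∀ a b c d : ℝ, HasDerivAt (fun h : ℝ => a * h ^ 3 + b * h ^ 2 + c * h + d)
        (3 * a * x ^ 2 + 2 * b * x + c) x := by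
      intro a b c d
      have := ((((hasDerivAt_pow 3 x).const_mul a).add ((hasDerivAt_pow 2 x).const_mul b)).add
        ((hasDerivAt_id x).const_mul c)).add_const d
      refine this.congr_deriv ?_
      norm_num; ring
    exact (((Real.hasDerivAt_exp x).mul (hp a b c d)).add (hp a' b' c' d')).congr_deriv (by ring)
  have step : ∀ (a b c d a' b' c' d' : ℝ), 0 ≤ d + d' →
      (∀ x : ℝ, 0 ≤ x → 0 ≤
        (Real.exp x * (a * x ^ 3 + (b + 3 * a) * x ^ 2 + (c + 2 * b) * x + (d + c)) +
          (0 * x ^ 3 + 3 * a' * x ^ 2 + 2 * b' * x + c'))) →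
      ∀ x : ℝ, 0 ≤ x → 0 ≤ Real.exp x * (a * x ^ 3 + b * x ^ 2 + c * x + d) +
        (a' * x ^ 3 + b' * x ^ 2 + c' * x + d') := by
    intro a b c d a' b' c' d' h0 hn
    exact nonneg_of_hasDerivAt_nonneg (by simpa using h0) (fun x _ => key a b c d a' b' c' d' x) hn
  have h4 : ∀ x : ℝ, 0 ≤ x → 0 ≤ Real.exp x * (1 * x ^ 3 + (-3) * x ^ 2 + 6 * x + (-6)) +
      (0 * x ^ 3 + 0 * x ^ 2 + 0 * x + 6) := by
    refine step _ _ _ _ _ _ _ _ (by norm_num) fun x hx => ?_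
    have : 0 ≤ Real.exp x * x ^ 3 := by positivity
    linarith
  have h3 : ∀ x : ℝ, 0 ≤ x → 0 ≤ Real.exp x * (1 * x ^ 3 + (-6) * x ^ 2 + 18 * x + (-24)) +
      (0 * x ^ 3 + 0 * x ^ 2 + 6 * x + 24) := by
    refine step _ _ _ _ _ _ _ _ (by norm_num) fun x hx => ?_
    have := h4 x hx
    linarith
  have h2 : ∀ x : ℝ, 0 ≤ x → 0 ≤ Real.exp x * (1 * x ^ 3 + (-9) * x ^ 2 + 36 * x + (-60)) +
      (0 * x ^ 3 + 3 * x ^ 2 + 24 * x + 60) := by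
    refine step _ _ _ _ _ _ _ _ (by norm_num) fun x hx => ?_
    have := h3 x hx
    linarith
  have h1 : ∀ x : ℝ, 0 ≤ x → 0 ≤ Real.exp x * (1 * x ^ 3 + (-12) * x ^ 2 + 60 * x + (-120)) +
      (1 * x ^ 3 + 12 * x ^ 2 + 60 * x + 120) := by
    refine step _ _ _ _ _ _ _ _ (by norm_num) fun x hx => ?_
    have := h2 x hx
    linarith
  have := h1 h hh
  linarith

lemma log_one_add_le_pade (x : ℝ) (hx : 0 ≤ x) :
    Real.log (1 + x) * (6 + 4 * x) ≤ x * (6 + x) := by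
  have h := nonneg_of_hasDerivAt_nonneg (f := fun x => x * (6 + x) / (6 + 4 * x) - Real.log (1 + x))
    (f' := fun x => 4 * x ^ 3 / ((6 + 4 * x) ^ 2 * (1 + x))) (by simp) (fun x hx => ?_)
    (fun x hx => by positivity) x hx
  · have h6 : 0 < 6 + 4 * x := by positivity
    rw [sub_nonneg, le_div_iff₀ h6] at h
    exact h
  · have h6 : 6 + 4 * x ≠ 0 := by positivity
    have h1 : 1 + x ≠ 0 := by positivity
    have := (((hasDerivAt_id x).mul ((hasDerivAt_id x).const_add 6)).div
      (((hasDerivAt_id x).const_mul 4).const_add 6) h6).sub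
      (((hasDerivAt_id x).const_add 1).log h1)
    refine this.congr_deriv ?_
    simp only [id, Pi.mul_apply]
    field_simp
    ring

/-- This is `log_gap_ineq` after the substitution `L = r (2 + g) / (r + 2)`: `g` measures the excess
of `L` over the lower bound `2r / (r + 2)`, and `hg2` is the upper Padé bound. -/
lemma pade_gap_ineq (r g : ℝ) (h1 : 1 ≤ r) (h2 : r ≤ 12) (hg : 0 ≤ g)
    (hg2 : g * (6 + 4 * r) ≤ r ^ 2) :
    g * (r + 2) ^ 2 * (60 * (r + 2) ^ 2 + (r - 1) ^ 2 * (2 + g) ^ 2) ≤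
      10 * (2 + g) ^ 2 * (r ^ 2 + 3 * r + (r + 1) * g) ^ 2 := by
  have s1 : ((r + 2) * (r - 1)) ^ 2 ≤ 20 * (r * (r + 3)) * (r + 1) := by
    have e : r * (r + 3) = (r + 2) * (r - 1) + 2 * (r + 1) := by ring
    have a1 : 0 ≤ (r + 2) * (r - 1) := mul_nonneg (by linarith) (by linarith)
    have a2 : (r + 2) * (r - 1) ≤ 20 * (r + 1) := by nlinarith
    nlinarith [mul_le_mul_of_nonneg_left a2 a1]
  have s2 : 10 * (r * (r + 3)) ^ 2 ≤
      10 * (r ^ 2 + 3 * r + (r + 1) * g) ^ 2 - g * ((r + 2) * (r - 1)) ^ 2 := by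
    have := mul_le_mul_of_nonneg_left s1 hg
    nlinarith [sq_nonneg ((r + 1) * g)]
  have s3 : 6 * g * (r + 2) ^ 4 ≤ (2 + g) ^ 2 * (r * (r + 3)) ^ 2 := by
    -- The quantity to bound is `g / (2 + g) ^ 2`, which increases up to `g = 2`. For `r ≤ 8` the
    -- bound `hg2` keeps `g ≤ 2`, so the extreme value `g = r ^ 2 / (6 + 4 * r)` is the worst; for
    -- `r ≥ 8` the global maximum `1 / 8` suffices.
    rcases le_total r 8 with h8 | h8
    · have q : 12 * (r + 2) ^ 2 * (2 * r + 3) ≤ ((r + 6) * (r + 3)) ^ 2 := by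
        nlinarith [sq_nonneg (r ^ 2 - 3 * r - 12)]
      have hG : 0 < 6 + 4 * r := by linarith
      have hgb : g * r ^ 2 ≤ 4 * (6 + 4 * r) := by
        have hg3 : g ≤ 2 := by nlinarith
        nlinarith
      have t1 : g * (2 * (6 + 4 * r) + r ^ 2) ^ 2 ≤ (2 + g) ^ 2 * r ^ 2 * (6 + 4 * r) := by
        nlinarith [mul_nonneg (sub_nonneg.2 hg2) (sub_nonneg.2 hgb)]
      have t2 : 2 * (6 + 4 * r) + r ^ 2 = (r + 2) * (r + 6) := by ring
      rw [t2] at t1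
      have t3 := mul_le_mul_of_nonneg_left q (mul_nonneg hg (sq_nonneg (r + 2)))
      have t4 := mul_le_mul_of_nonneg_right t1 (sq_nonneg (r + 3))
      have t5 : (6 * g * (r + 2) ^ 4) * (6 + 4 * r) ≤
          ((2 + g) ^ 2 * (r * (r + 3)) ^ 2) * (6 + 4 * r) := by linarith
      exact le_of_mul_le_mul_right t5 hG
    · have q : 3 * (r + 2) ^ 4 ≤ 4 * (r * (r + 3)) ^ 2 := by
        have : 0 ≤ r - 8 := by linarith
        obtain ⟨t, rfl⟩ : ∃ t, r = t + 8 := ⟨r - 8, by ring⟩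
        have ht : 0 ≤ t := by linarith
        have : 4 * ((t + 8) * (t + 8 + 3)) ^ 2 - 3 * (t + 8 + 2) ^ 4 =
          t ^ 4 + 32 * t ^ 3 + 348 * t ^ 2 + 1376 * t + 976 := by ring
        have : 0 ≤ t ^ 4 + 32 * t ^ 3 + 348 * t ^ 2 + 1376 * t + 976 := by positivity
        linarith
      have q2 : 8 * g ≤ (2 + g) ^ 2 := by nlinarith [sq_nonneg (g - 2)]
      nlinarith [mul_le_mul_of_nonneg_right q2 (sq_nonneg (r * (r + 3))),
        mul_le_mul_of_nonneg_left q hg]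
  have := mul_le_mul_of_nonneg_left s2 (sq_nonneg (2 + g))
  nlinarith

lemma log_gap_ineq (r L : ℝ) (h1 : 1 ≤ r) (h2 : r ≤ 12) (hl : 2 * r ≤ (r + 2) * L)
    (hu : L * (6 + 4 * r) ≤ r * (6 + r)) :
    r * (60 * r ^ 2 + (r - 1) ^ 2 * L ^ 2) * ((r + 2) * L - 2 * r) ≤
      10 * L ^ 2 * ((r + 1) * L + r * (r - 1)) ^ 2 := by
  have hr : 0 < r := by linarith
  have hr2 : 0 < r + 2 := by linarith
  obtain ⟨g, rfl⟩ : ∃ g, L = r * (2 + g) / (r + 2) :=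
    ⟨(r + 2) * L / r - 2, by field_simp; ring⟩
  have e1 : (r + 2) * (r * (2 + g) / (r + 2)) = r * (2 + g) := by field_simp
  rw [e1] at hl ⊢
  have hg : 0 ≤ g := by nlinarith
  have hg2 : g * (6 + 4 * r) ≤ r ^ 2 := by
    rw [div_mul_eq_mul_div, div_le_iff₀ hr2] at hu
    have : (2 + g) * (6 + 4 * r) ≤ (6 + r) * (r + 2) := by
      have : r * ((2 + g) * (6 + 4 * r)) ≤ r * ((6 + r) * (r + 2)) := by linarith
      exact le_of_mul_le_mul_left this hr
    nlinarith
  have := pade_gap_ineq r g h1 h2 hg hg2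
  have e2 : 10 * (r * (2 + g) / (r + 2)) ^ 2 *
      ((r + 1) * (r * (2 + g) / (r + 2)) + r * (r - 1)) ^ 2 -
      r * (60 * r ^ 2 + (r - 1) ^ 2 * (r * (2 + g) / (r + 2)) ^ 2) * (r * (2 + g) - 2 * r) =
      r ^ 4 / (r + 2) ^ 4 * (10 * (2 + g) ^ 2 * (r ^ 2 + 3 * r + (r + 1) * g) ^ 2 -
        g * (r + 2) ^ 2 * (60 * (r + 2) ^ 2 + (r - 1) ^ 2 * (2 + g) ^ 2)) := by
    field_simp
    ring
  have e3 : 0 ≤ r ^ 4 / (r + 2) ^ 4 * (10 * (2 + g) ^ 2 * (r ^ 2 + 3 * r + (r + 1) * g) ^ 2 -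
        g * (r + 2) ^ 2 * (60 * (r + 2) ^ 2 + (r - 1) ^ 2 * (2 + g) ^ 2)) :=
    mul_nonneg (by positivity) (by linarith)
  linarith

lemma log_large_ineq (r : ℝ) (h : 11.5 ≤ r) :
    r * (2 * Real.log (r + 1) * (r + 1) ^ 2 + (r - 1) * r * (r ^ 2 + 5 * r + 2)) ≤
      (r + 1) * ((r + 1) * Real.log (r + 1) + r * (r - 1)) ^ 2 := by
  -- The value 2.5 makes the `r ^ 4` terms cancel in `t3`, and `exp 2.5 ≤ 12.5` is why the range
  -- starts at `r = 11.5`.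
  have hL : 2.5 ≤ Real.log (r + 1) := by
    rw [Real.le_log_iff_exp_le (by linarith)]
    have e1 : Real.exp 2.5 ^ 2 = Real.exp 1 ^ 5 := by
      rw [← Real.exp_nat_mul, ← Real.exp_nat_mul]; norm_num
    have e2 : Real.exp 1 ^ 5 ≤ 2.7182818286 ^ 5 :=
      pow_le_pow_left₀ (Real.exp_pos 1).le Real.exp_one_lt_d9.le 5
    have e3 : Real.exp 2.5 ≤ 12.5 := by
      refine le_of_sq_le_sq ?_ (by norm_num)
      rw [e1]; refine e2.trans (by norm_num)
    linarith
  set L := Real.log (r + 1)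
  have e : (r + 1) * ((r + 1) * L + r * (r - 1)) ^ 2 -
      r * (2 * L * (r + 1) ^ 2 + (r - 1) * r * (r ^ 2 + 5 * r + 2)) =
      -5 * r ^ 4 + 2 * r ^ 3 + 3 * r ^ 2 + 2 * L * (r + 1) * (r ^ 3 - r ^ 2 - 2 * r) +
        (r + 1) ^ 3 * L ^ 2 := by ring
  have c : 0 ≤ r ^ 3 - r ^ 2 - 2 * r := by
    have : r ^ 3 - r ^ 2 - 2 * r = r * ((r - 2) * (r + 1)) := by ring
    rw [this]; exact mul_nonneg (by linarith) (mul_nonneg (by linarith) (by linarith))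
  have t1 : 2 * 2.5 * (r + 1) * (r ^ 3 - r ^ 2 - 2 * r) ≤
      2 * L * (r + 1) * (r ^ 3 - r ^ 2 - 2 * r) := by
    have : 0 ≤ r + 1 := by linarith
    gcongr
  have t2 : (r + 1) ^ 3 * 2.5 ^ 2 ≤ (r + 1) ^ 3 * L ^ 2 := by
    have : 0 ≤ r + 1 := by linarith
    gcongr
  have t3 : 0 ≤ -5 * r ^ 4 + 2 * r ^ 3 + 3 * r ^ 2 + 2 * 2.5 * (r + 1) * (r ^ 3 - r ^ 2 - 2 * r) +
      (r + 1) ^ 3 * 2.5 ^ 2 := by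
    have : -5 * r ^ 4 + 2 * r ^ 3 + 3 * r ^ 2 + 2 * 2.5 * (r + 1) * (r ^ 3 - r ^ 2 - 2 * r) +
      (r + 1) ^ 3 * 2.5 ^ 2 = 8.25 * r ^ 3 + 6.75 * r ^ 2 + 8.75 * r + 6.25 := by ring
    rw [this]
    have : 0 ≤ r := by linarith
    positivity
  linarith

/-! ### Monotonicity and convexity of `powerQuot` -/

/-- `(1 - 1/r) log (r + 1)`, the exponent in the limiting boundary function. -/
noncomputable def logExponent (r : ℝ) : ℝ := (r - 1) / r * Real.log (r + 1)

/-- The first derivative of `logExponent`. -/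
noncomputable def logExponentDeriv (r : ℝ) : ℝ :=
  Real.log (r + 1) / r ^ 2 + (r - 1) / (r * (r + 1))

/-- The second derivative of `logExponent`. -/
noncomputable def logExponentDeriv2 (r : ℝ) : ℝ :=
  -2 * Real.log (r + 1) / r ^ 3 + 2 / (r ^ 2 * (r + 1)) - (r - 1) / (r * (r + 1) ^ 2)

/-- `(r - 1) / ((r + 1) ^ (k (1 - 1/r)) - 1)`, which is `δ(r, s) + 1 / k` for `k = s / (s - 1)`. -/
noncomputable def powerQuot (k r : ℝ) : ℝ := (r - 1) / (Real.exp (k * logExponent r) - 1)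

lemma logExponent_pos {r : ℝ} (hr : 1 < r) : 0 < logExponent r :=
  mul_pos (div_pos (by linarith) (by linarith)) (Real.log_pos (by linarith))

lemma logExponentDeriv_pos {r : ℝ} (hr : 1 < r) : 0 < logExponentDeriv r := by
  have h0 : 0 < r - 1 := by linarith
  have h1 : 0 < r := by linarith
  have h2 : 0 < Real.log (r + 1) := Real.log_pos (by linarith)
  unfold logExponentDeriv
  positivity

lemma hasDerivAt_logExponent {r : ℝ} (hr : 0 < r) :
    HasDerivAt logExponent (logExponentDeriv r) r := by
  have h1 : r + 1 ≠ 0 := by positivity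
  have h := (((hasDerivAt_id r).sub_const 1).div (hasDerivAt_id r) hr.ne').mul
    (((hasDerivAt_id r).add_const 1).log h1)
  refine h.congr_deriv ?_
  simp only [id, Pi.div_apply, logExponentDeriv]
  field_simp
  ring

lemma hasDerivAt_logExponentDeriv {r : ℝ} (hr : 0 < r) :
    HasDerivAt logExponentDeriv (logExponentDeriv2 r) r := by
  have h1 : r + 1 ≠ 0 := by positivity
  have hr' := hr.ne'
  have h := ((((hasDerivAt_id r).add_const 1).log h1).div (hasDerivAt_pow 2 r)
    (pow_ne_zero 2 hr')).add (((hasDerivAt_id r).sub_const 1).div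
    ((hasDerivAt_id r).mul ((hasDerivAt_id r).add_const 1)) (mul_ne_zero hr' h1))
  refine h.congr_deriv ?_
  simp only [id, Pi.mul_apply, logExponentDeriv2]
  field_simp
  ring

lemma exp_mul_logExponent {r : ℝ} (hr : 1 < r) (k : ℝ) :
    Real.exp (k * logExponent r) = (1 + r) ^ (k * (r - 1) / r) := by
  rw [Real.rpow_def_of_pos (by linarith), logExponent, add_comm 1 r]
  congr 1
  ring

lemma exp_mul_logExponent_le {r k : ℝ} (hr : 1 < r) (hk : 0 < k) (hkr : k * (r - 1) ≤ r) :
    Real.exp (k * logExponent r) - 1 ≤ k * (r - 1) := by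
  have hr0 : 0 < r := by linarith
  rw [exp_mul_logExponent hr]
  have := rpow_one_add_le_one_add_mul_self (s := r) (by linarith) (p := k * (r - 1) / r)
    (div_nonneg (mul_nonneg hk.le (by linarith)) hr0.le) ((div_le_one hr0).2 hkr)
  rw [div_mul_cancel₀ _ hr0.ne'] at this
  linarith

lemma exp_mul_logExponent_lt {r k : ℝ} (hr : 1 < r) (hk : 0 < k) (hkr : k * (r - 1) < r) :
    Real.exp (k * logExponent r) - 1 < k * (r - 1) := by
  have hr0 : 0 < r := by linarith
  rw [exp_mul_logExponent hr]
  have := rpow_one_add_lt_one_add_mul_self (s := r) (by linarith) hr0.ne' (p := k * (r - 1) / r)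
    (div_pos (mul_pos hk (by linarith)) hr0) ((div_lt_one hr0).2 hkr)
  rw [div_mul_cancel₀ _ hr0.ne'] at this
  linarith

lemma exp_mul_logExponent_sub_one_pos {r k : ℝ} (hr : 1 < r) (hk : 0 < k) :
    0 < Real.exp (k * logExponent r) - 1 := by
  have := Real.add_one_lt_exp (mul_pos hk (logExponent_pos hr)).ne'
  have := mul_pos hk (logExponent_pos hr)
  linarith

/-- The sign condition for the second derivative of `powerQuot`. -/
lemma powerQuot_convexity_ineq {r k : ℝ} (hr : 1 < r) (hk : 1 ≤ k) (hkr : k * (r - 1) ≤ r) :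
    (2 * logExponentDeriv r + (r - 1) * logExponentDeriv2 r) *
      (Real.exp (k * logExponent r) - 1) ≤
    (r - 1) * k * logExponentDeriv r ^ 2 * (Real.exp (k * logExponent r) + 1) := by
  have hr0 : 0 < r := by linarith
  have hk0 : 0 < k := by linarith
  have hy : 0 < r - 1 := by linarith
  have hD := logExponentDeriv_pos hr
  have hh0 := logExponent_pos hr
  have hE := exp_mul_logExponent_sub_one_pos hr hk0
  have hEb := exp_mul_logExponent_le hr hk0 hkr
  have hL : 0 < Real.log (r + 1) := Real.log_pos (by linarith)
  -- Up to 12, the Padé bound for `(E - 1) / (E + 1)` leaves an inequality between `r` and `log (r +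
  -- 1)`. Beyond 12, the bound `E - 1 ≤ k (r - 1)` is enough.
  rcases le_total r 12 with h12 | h12
  · have hpade := exp_pade_nonneg (k * logExponent r) (mul_pos hk0 hh0).le
    have hkey : (2 * logExponentDeriv r + (r - 1) * logExponentDeriv2 r) * logExponent r *
        (60 + logExponent r ^ 2) ≤
        2 * (r - 1) * logExponentDeriv r ^ 2 * (60 + 6 * logExponent r ^ 2) := by
      have hl : 2 * r ≤ (r + 2) * Real.log (r + 1) := by
        have := Real.le_log_one_add_of_nonneg hr0.le
        rw [div_le_iff₀ (by linarith), add_comm 1 r] at this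
        linarith
      have hu := log_one_add_le_pade r hr0.le
      rw [add_comm 1 r] at hu
      have := log_gap_ineq r _ hr.le h12 hl hu
      have e : 2 * (r - 1) * logExponentDeriv r ^ 2 * (60 + 6 * logExponent r ^ 2) -
          (2 * logExponentDeriv r + (r - 1) * logExponentDeriv2 r) * logExponent r *
            (60 + logExponent r ^ 2) =
          (r - 1) ^ 3 / (r ^ 6 * (r + 1) ^ 2) *
          (10 * Real.log (r + 1) ^ 2 * ((r + 1) * Real.log (r + 1) + r * (r - 1)) ^ 2 -
          r * (60 * r ^ 2 + (r - 1) ^ 2 * Real.log (r + 1) ^ 2) *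
            ((r + 2) * Real.log (r + 1) - 2 * r)) := by
        unfold logExponentDeriv logExponent logExponentDeriv2
        field_simp
        ring
      have : 0 ≤ (r - 1) ^ 3 / (r ^ 6 * (r + 1) ^ 2) *
          (10 * Real.log (r + 1) ^ 2 * ((r + 1) * Real.log (r + 1) + r * (r - 1)) ^ 2 -
          r * (60 * r ^ 2 + (r - 1) ^ 2 * Real.log (r + 1) ^ 2) *
            ((r + 2) * Real.log (r + 1) - 2 * r)) := mul_nonneg (by positivity) (by linarith)
      linarith
    generalize logExponent r = h at *
    generalize 2 * logExponentDeriv r + (r - 1) * logExponentDeriv2 r = D2 at *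
    generalize logExponentDeriv r = D1 at *
    generalize Real.exp (k * h) = E at *
    have hA : 0 ≤ (r - 1) * D1 ^ 2 := by positivity
    -- Weakening `hkey` by `60 + 6 h² ≤ 6 (60 + h²)` gives the coefficient of `(k² - 1) h²` needed
    -- to pass from `k = 1` to general `k ≥ 1` in `hC`.
    have hB : D2 * h ≤ 12 * ((r - 1) * D1 ^ 2) := by
      have : D2 * h * (60 + h ^ 2) ≤ 12 * ((r - 1) * D1 ^ 2) * (60 + h ^ 2) := by nlinarith
      exact le_of_mul_le_mul_right this (by positivity)
    have hC : D2 * h * (60 + (k * h) ^ 2) ≤ 2 * ((r - 1) * D1 ^ 2) * (60 + 6 * (k * h) ^ 2) := by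
      have hk2 : 0 ≤ (k ^ 2 - 1) * h ^ 2 := mul_nonneg (by nlinarith) (sq_nonneg h)
      nlinarith [mul_le_mul_of_nonneg_left hB hk2]
    have hP : 2 * (60 + 6 * (k * h) ^ 2) * (E - 1) ≤ (E + 1) * (k * h) * (60 + (k * h) ^ 2) := by
      linarith
    have h1 := mul_le_mul_of_nonneg_right hC hE.le
    have h2 := mul_le_mul_of_nonneg_left hP hA
    have h3 : D2 * (E - 1) * (h * (60 + (k * h) ^ 2)) ≤
        (r - 1) * k * D1 ^ 2 * (E + 1) * (h * (60 + (k * h) ^ 2)) := by linarith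
    exact le_of_mul_le_mul_right h3 (by positivity)
  · have hkey : 2 * logExponentDeriv r + (r - 1) * logExponentDeriv2 r ≤
        (r + 1) * logExponentDeriv r ^ 2 := by
      have := log_large_ineq r (by linarith)
      have e : (r + 1) * logExponentDeriv r ^ 2 -
          (2 * logExponentDeriv r + (r - 1) * logExponentDeriv2 r) =
          1 / (r ^ 4 * (r + 1) ^ 2) * ((r + 1) * ((r + 1) * Real.log (r + 1) + r * (r - 1)) ^ 2 -
          r * (2 * Real.log (r + 1) * (r + 1) ^ 2 + (r - 1) * r * (r ^ 2 + 5 * r + 2))) := by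
        unfold logExponentDeriv logExponentDeriv2
        field_simp
        ring
      have : 0 ≤ 1 / (r ^ 4 * (r + 1) ^ 2) *
          ((r + 1) * ((r + 1) * Real.log (r + 1) + r * (r - 1)) ^ 2 -
          r * (2 * Real.log (r + 1) * (r + 1) ^ 2 + (r - 1) * r * (r ^ 2 + 5 * r + 2))) :=
        mul_nonneg (by positivity) (by linarith)
      linarith
    generalize 2 * logExponentDeriv r + (r - 1) * logExponentDeriv2 r = D2 at *
    generalize logExponentDeriv r = D1 at *
    generalize Real.exp (k * logExponent r) = E at *
    have hA : 0 ≤ D1 ^ 2 := by positivity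
    have h1 := mul_le_mul_of_nonneg_right hkey hE.le
    have h2 := mul_le_mul_of_nonneg_left hEb hA
    have h3 : 0 ≤ (r - 1) * D1 ^ 2 * (E - 1) * (k - 1) :=
      mul_nonneg (by positivity) (by linarith)
    nlinarith

lemma hasDerivAt_exp_mul_logExponent {r : ℝ} (hr : 0 < r) (k : ℝ) :
    HasDerivAt (fun r => Real.exp (k * logExponent r))
      (Real.exp (k * logExponent r) * (k * logExponentDeriv r)) r :=
  ((hasDerivAt_logExponent hr).const_mul k).exp

lemma hasDerivAt_powerQuot {r k : ℝ} (hr : 1 < r) (hk : 0 < k) :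
    HasDerivAt (powerQuot k) ((Real.exp (k * logExponent r) - 1 -
      (r - 1) * (Real.exp (k * logExponent r) * (k * logExponentDeriv r))) /
      (Real.exp (k * logExponent r) - 1) ^ 2) r := by
  have h := ((hasDerivAt_id r).sub_const 1).div
    ((hasDerivAt_exp_mul_logExponent (by linarith) k).sub_const 1)
    (exp_mul_logExponent_sub_one_pos hr hk).ne'
  refine h.congr_deriv ?_
  simp only [id]
  ring

lemma hasDerivAt_powerQuot_deriv {r k : ℝ} (hr : 1 < r) (hk : 0 < k) :
    HasDerivAt (fun r => (Real.exp (k * logExponent r) - 1 -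
      (r - 1) * (Real.exp (k * logExponent r) * (k * logExponentDeriv r))) /
      (Real.exp (k * logExponent r) - 1) ^ 2)
      (k * Real.exp (k * logExponent r) / (Real.exp (k * logExponent r) - 1) ^ 3 *
        ((r - 1) * k * logExponentDeriv r ^ 2 * (Real.exp (k * logExponent r) + 1) -
          (2 * logExponentDeriv r + (r - 1) * logExponentDeriv2 r) *
            (Real.exp (k * logExponent r) - 1))) r := by
  have hr0 : 0 < r := by linarith
  have hE0 := (exp_mul_logExponent_sub_one_pos hr hk).ne'
  have hE := hasDerivAt_exp_mul_logExponent hr0 k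
  have h := ((hE.sub_const 1).sub (((hasDerivAt_id r).sub_const 1).mul
    (hE.mul ((hasDerivAt_logExponentDeriv hr0).const_mul k)))).div ((hE.sub_const 1).pow 2)
    (pow_ne_zero 2 hE0)
  refine h.congr_deriv ?_
  simp only [id, Pi.mul_apply, Pi.sub_apply, Pi.pow_apply]
  generalize Real.exp (k * logExponent r) = E at *
  field_simp
  ring

lemma convexOn_powerQuot {k : ℝ} (hk : 1 ≤ k) {S : Set ℝ} (hS : Convex ℝ S) (hSo : IsOpen S)
    (hS1 : ∀ r ∈ S, 1 < r) (hSk : ∀ r ∈ S, k * (r - 1) ≤ r) : ConvexOn ℝ S (powerQuot k) := by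
  have hk0 : 0 < k := by linarith
  refine convexOn_of_hasDerivWithinAt2_nonneg hS
    (f' := fun r => (Real.exp (k * logExponent r) - 1 -
      (r - 1) * (Real.exp (k * logExponent r) * (k * logExponentDeriv r))) /
      (Real.exp (k * logExponent r) - 1) ^ 2)
    (f'' := fun r => k * Real.exp (k * logExponent r) / (Real.exp (k * logExponent r) - 1) ^ 3 *
        ((r - 1) * k * logExponentDeriv r ^ 2 * (Real.exp (k * logExponent r) + 1) -
          (2 * logExponentDeriv r + (r - 1) * logExponentDeriv2 r) *
            (Real.exp (k * logExponent r) - 1)))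
    (fun r hr => (hasDerivAt_powerQuot (hS1 r hr) hk0).continuousAt.continuousWithinAt)
    (fun r hr => ?_) (fun r hr => ?_) (fun r hr => ?_)
  · rw [hSo.interior_eq] at hr
    exact (hasDerivAt_powerQuot (hS1 r hr) hk0).hasDerivWithinAt
  · rw [hSo.interior_eq] at hr
    exact (hasDerivAt_powerQuot_deriv (hS1 r hr) hk0).hasDerivWithinAt
  · rw [hSo.interior_eq] at hr
    have h1 := exp_mul_logExponent_sub_one_pos (hS1 r hr) hk0
    have h2 := powerQuot_convexity_ineq (hS1 r hr) hk (hSk r hr)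
    exact mul_nonneg (by positivity) (by linarith)

/-- The power `(r + 1) ^ (1 - 1/r)` equals `(r + 1) exp (-log (r + 1) / r)`, whose last factor tends
to 1. -/
lemma tendsto_powerQuot_one_atTop : Tendsto (powerQuot 1) atTop (𝓝 1) := by
  have hlog : Tendsto (fun r : ℝ => Real.log (r + 1) / r) atTop (𝓝 0) := by
    have h := (Real.tendsto_pow_log_div_mul_add_atTop 1 (-1) 1 one_ne_zero).comp
      (tendsto_atTop_add_const_right atTop (1 : ℝ) tendsto_id)
    refine h.congr fun r => ?_
    simp
  have hinv : Tendsto (fun r : ℝ => r⁻¹) atTop (𝓝 0) := tendsto_inv_atTop_zero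
  have he : Tendsto (fun r : ℝ => Real.exp (-(Real.log (r + 1) / r))) atTop (𝓝 1) := by
    have := (Real.continuous_exp.tendsto _).comp hlog.neg
    simpa [Function.comp_def] using this
  have h : Tendsto (fun r : ℝ => (1 - r⁻¹) /
      ((1 + r⁻¹) * Real.exp (-(Real.log (r + 1) / r)) - r⁻¹)) atTop
      (𝓝 ((1 - 0) / ((1 + 0) * 1 - 0))) :=
    (hinv.const_sub 1).div (((hinv.const_add 1).mul he).sub hinv) (by norm_num)
  have h1 : ((1 : ℝ) - 0) / ((1 + 0) * 1 - 0) = 1 := by norm_num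
  rw [h1] at h
  refine h.congr' ?_
  filter_upwards [eventually_gt_atTop 1] with r hr
  have hr0 : r ≠ 0 := by positivity
  have e : Real.exp (1 * logExponent r) = (r + 1) * Real.exp (-(Real.log (r + 1) / r)) := by
    rw [← Real.exp_log (show 0 < r + 1 by linarith), ← Real.exp_add,
      Real.exp_log (show 0 < r + 1 by linarith), logExponent]
    congr 1
    field_simp
    ring
  rw [powerQuot, e, ← mul_div_mul_left _ _ hr0]
  congr 1 <;> field_simp

/-- A convex function with a finite limit at infinity cannot have a positive slope: each chord slope
is at most the slopes of chords to far points, and these tend to 0. -/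
lemma antitoneOn_powerQuot_one : AntitoneOn (powerQuot 1) (Set.Ioi 1) := by
  have hc : ConvexOn ℝ (Set.Ioi 1) (powerQuot 1) :=
    convexOn_powerQuot le_rfl (convex_Ioi 1) isOpen_Ioi (fun r hr => hr)
      (fun r _ => by linarith)
  intro a ha b hb hab
  rcases hab.eq_or_lt with rfl | hab
  · exact le_rfl
  have hlim : Tendsto (fun r => (powerQuot 1 r - powerQuot 1 b) / (r - b)) atTop (𝓝 0) :=
    (tendsto_powerQuot_one_atTop.sub_const _).div_atTop
      (tendsto_atTop_add_const_right atTop (-b) tendsto_id)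
  have := ge_of_tendsto hlim (b := (powerQuot 1 b - powerQuot 1 a) / (b - a)) <| by
    filter_upwards [eventually_gt_atTop b] with r hr
    exact hc.slope_mono_adjacent ha (Set.mem_Ioi.2 (lt_trans hb hr)) hab hr
  rw [div_le_iff₀ (by linarith)] at this
  linarith

lemma exp_sub_one_le_of_one {r : ℝ} (hr : 1 < r) :
    Real.exp (logExponent r) - 1 ≤ (r - 1) * (Real.exp (logExponent r) * logExponentDeriv r) := by
  have hd := hasDerivAt_powerQuot hr one_pos
  have h0 := exp_mul_logExponent_sub_one_pos hr one_pos
  have hle : derivWithin (powerQuot 1) (Set.Ioi 1) r ≤ 0 :=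
    antitoneOn_powerQuot_one.derivWithin_nonpos
  rw [hd.hasDerivWithinAt.derivWithin (isOpen_Ioi.uniqueDiffWithinAt hr), div_nonpos_iff] at hle
  simp only [one_mul] at hle h0
  rcases hle with h | h
  · have : 0 < (Real.exp (logExponent r) - 1) ^ 2 := by positivity
    linarith [h.2]
  · linarith [h.1]

/-- With `h = logExponent r`, the derivative is negative when `1 - exp (-k h) < k (r - 1) h'`.
Bernoulli bounds the left side strictly by `k (1 - exp (-h))`, and the case `k = 1` gives `1 - exp
(-h) ≤ (r - 1) h'`. -/
lemma strictAntiOn_powerQuot {k : ℝ} (hk : 1 < k) : StrictAntiOn (powerQuot k) (Set.Ioi 1) := by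
  have hk0 : 0 < k := by linarith
  refine strictAntiOn_of_deriv_neg (convex_Ioi 1)
    (fun r hr => (hasDerivAt_powerQuot hr hk0).continuousAt.continuousWithinAt) fun r hr => ?_
  rw [interior_Ioi] at hr
  have hr1 : 1 < r := hr
  rw [(hasDerivAt_powerQuot hr hk0).deriv]
  have h0 := exp_mul_logExponent_sub_one_pos hr1 hk0
  refine div_neg_of_neg_of_pos ?_ (by positivity)
  have h1 := exp_sub_one_le_of_one hr1
  have hh := logExponent_pos hr1
  have e1 : Real.exp (k * logExponent r) * Real.exp (-(k * logExponent r)) = 1 := by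
    rw [← Real.exp_add, add_neg_cancel, Real.exp_zero]
  have e2 : Real.exp (logExponent r) * Real.exp (-(logExponent r)) = 1 := by
    rw [← Real.exp_add, add_neg_cancel, Real.exp_zero]
  have hb : 1 - Real.exp (-(k * logExponent r)) < k * (1 - Real.exp (-logExponent r)) := by
    have hlt : Real.exp (-logExponent r) < 1 := by
      rw [← Real.exp_zero]; exact Real.exp_lt_exp.2 (by linarith)
    have := one_add_mul_self_lt_rpow_one_add (s := Real.exp (-logExponent r) - 1)
      (by linarith [Real.exp_pos (-logExponent r)]) (by linarith) hk
    rw [add_sub_cancel, ← Real.exp_mul] at this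
    have e : -logExponent r * k = -(k * logExponent r) := by ring
    rw [e] at this
    linarith
  have h2 : 1 - Real.exp (-logExponent r) ≤ (r - 1) * logExponentDeriv r := by
    have := mul_le_mul_of_nonneg_right h1 (Real.exp_pos (-logExponent r)).le
    have e : (r - 1) * (Real.exp (logExponent r) * logExponentDeriv r) *
        Real.exp (-logExponent r) = (r - 1) * logExponentDeriv r := by
      linear_combination (r - 1) * logExponentDeriv r * e2
    linarith
  have h3 := hb.trans_le (mul_le_mul_of_nonneg_left h2 hk0.le)
  have h4 := mul_lt_mul_of_pos_left h3 (Real.exp_pos (k * logExponent r))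
  linarith

/-- By monotonicity the values near 1 dominate, and there `exp h - 1 ≥ h` bounds the quotient by `t
/ log (t + 1)`, which tends to `1 / log 2`. -/
lemma powerQuot_le_one_div_log_two {r : ℝ} (hr : 1 < r) : powerQuot 1 r ≤ 1 / Real.log 2 := by
  have hlim : Tendsto (fun t : ℝ => t / Real.log (t + 1)) (𝓝[>] 1) (𝓝 (1 / Real.log 2)) := by
    have : ContinuousAt (fun t : ℝ => t / Real.log (t + 1)) 1 := by
      refine continuousAt_id.div ((continuousAt_id.add continuousAt_const).log (by norm_num)) ?_
      exact (Real.log_pos (by norm_num)).ne'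
    have h := this.tendsto
    norm_num at h
    simpa using h.mono_left nhdsWithin_le_nhds
  refine ge_of_tendsto hlim ?_
  filter_upwards [Ioo_mem_nhdsGT hr] with t ht
  have h1 := ht.1
  refine (antitoneOn_powerQuot_one h1 hr ht.2.le).trans ?_
  have hpos := logExponent_pos h1
  have hle : logExponent t ≤ Real.exp (1 * logExponent t) - 1 := by
    have := Real.add_one_le_exp (logExponent t)
    rw [one_mul]; linarith
  have hL : 0 < Real.log (t + 1) := Real.log_pos (by linarith)
  refine (div_le_div_of_nonneg_left (by linarith) hpos hle).trans (le_of_eq ?_)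
  have : t - 1 ≠ 0 := by linarith
  unfold logExponent
  field_simp

lemma one_le_powerQuot_one {r : ℝ} (hr : 1 < r) : 1 ≤ powerQuot 1 r := by
  have := exp_mul_logExponent_le hr one_pos (by linarith)
  rw [powerQuot, le_div_iff₀ (exp_mul_logExponent_sub_one_pos hr one_pos)]
  linarith

lemma powerQuot_le_div {r k : ℝ} (hr : 1 < r) (hk : 1 ≤ k) :
    powerQuot k r ≤ powerQuot 1 r / k := by
  have h0 := exp_mul_logExponent_sub_one_pos hr one_pos
  have hb := one_add_mul_self_le_rpow_one_add (s := Real.exp (1 * logExponent r) - 1)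
    (by linarith) hk
  rw [add_sub_cancel, ← Real.exp_mul, one_mul, mul_comm (logExponent r) k] at hb
  rw [powerQuot, powerQuot, div_div]
  rw [one_mul] at h0 ⊢
  exact div_le_div_of_nonneg_left (by linarith) (mul_pos h0 (by linarith)) (by linarith)

/-! ### Properties of the boundary function -/

lemma boundaryDelta_eq {r s : ℝ} (hr : 1 < r) :
    boundaryDelta r s = powerQuot (s / (s - 1)) r - (1 - 1 / s) := by
  rw [boundaryDelta, powerQuot, exp_mul_logExponent hr, add_comm 1 r]
  have : s / (s - 1) * (r - 1) / r = s * (r - 1) / (r * (s - 1)) := by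
    rw [div_mul_eq_mul_div, div_div, mul_comm r]
  rw [this]
  ring

lemma div_sub_one_mul_lt {r s : ℝ} (hr : 1 < r) (hrs : r < s) : s / (s - 1) * (r - 1) < r := by
  rw [div_mul_eq_mul_div, div_lt_iff₀ (by linarith)]
  nlinarith

lemma one_lt_div_sub_one {s : ℝ} (hs : 1 < s) : 1 < s / (s - 1) := by
  rw [one_lt_div (by linarith)]
  linarith

lemma boundaryDelta_pos {r s : ℝ} (hr : 1 < r) (hrs : r < s) : 0 < boundaryDelta r s := by
  have hk := one_lt_div_sub_one (hr.trans hrs)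
  have hk0 : 0 < s / (s - 1) := by linarith
  rw [boundaryDelta_eq hr, sub_pos, powerQuot,
    lt_div_iff₀ (exp_mul_logExponent_sub_one_pos hr hk0)]
  have := exp_mul_logExponent_lt hr hk0 (div_sub_one_mul_lt hr hrs)
  have hs : 0 < s - 1 := by linarith
  have hs0 : 0 < s := by linarith
  have e : (1 - 1 / s) * (s / (s - 1) * (r - 1)) = r - 1 := by field_simp
  rw [← e]
  refine mul_lt_mul_of_pos_left this ?_
  rw [sub_pos, div_lt_one hs0]
  linarith

/-- The bound does not involve `s`; it yields both the constant `1 / log 2 - 1` and the uniform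
limit as `r → ∞`. -/
lemma boundaryDelta_le_powerQuot {r s : ℝ} (hr : 1 < r) (hrs : r < s) :
    boundaryDelta r s ≤ powerQuot 1 r - 1 := by
  have hk := one_lt_div_sub_one (hr.trans hrs)
  have h1 := powerQuot_le_div hr hk.le
  have h2 := one_le_powerQuot_one hr
  rw [boundaryDelta_eq hr]
  have hs : 0 < s - 1 := by linarith
  have hs0 : 0 < s := by linarith
  have e : powerQuot 1 r / (s / (s - 1)) - (1 - 1 / s) = (powerQuot 1 r - 1) * (1 - 1 / s) := by
    field_simp
  have h3 : (powerQuot 1 r - 1) * (1 - 1 / s) ≤ (powerQuot 1 r - 1) * 1 := by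
    refine mul_le_mul_of_nonneg_left ?_ (by linarith)
    have : 0 < 1 / s := by positivity
    linarith
  linarith

lemma boundaryDelta_strictAntiOn {s : ℝ} (hs : 1 < s) :
    StrictAntiOn (fun r => boundaryDelta r s) (Set.Ioo 1 s) := by
  intro a ha b hb hab
  simp only [boundaryDelta_eq ha.1, boundaryDelta_eq hb.1]
  have := strictAntiOn_powerQuot (one_lt_div_sub_one hs) ha.1 hb.1 hab
  linarith

lemma boundaryDelta_convexOn {s : ℝ} (hs : 1 < s) :
    ConvexOn ℝ (Set.Ioo 1 s) (fun r => boundaryDelta r s) := by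
  have h := (convexOn_powerQuot (one_lt_div_sub_one hs).le (convex_Ioo 1 s) isOpen_Ioo
    (fun r hr => hr.1) (fun r hr => (div_sub_one_mul_lt hr.1 hr.2).le)).add_const (-(1 - 1 / s))
  refine h.congr fun r hr => ?_
  simp only [Pi.add_apply]
  rw [boundaryDelta_eq hr.1]
  ring

lemma boundaryDelta_uniform_limit (ε : ℝ) (hε : 0 < ε) :
    ∃ R : ℝ, 1 < R ∧ ∀ r s : ℝ, R < r → r < s → |boundaryDelta r s| < ε := by
  have := tendsto_powerQuot_one_atTop.eventually (gt_mem_nhds (show 1 < 1 + ε by linarith))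
  obtain ⟨R, hR⟩ := eventually_atTop.1 this
  refine ⟨max R 2, by simp, fun r s hr hrs => ?_⟩
  have h1 : 1 < r := lt_of_le_of_lt (by norm_num) ((le_max_right R 2).trans_lt hr)
  rw [abs_of_pos (boundaryDelta_pos h1 hrs)]
  have := hR r ((le_max_left R 2).trans hr.le)
  linarith [boundaryDelta_le_powerQuot h1 hrs]

lemma tendsto_boundaryDelta_atTop {r : ℝ} (hr : 1 < r) :
    Tendsto (fun s => boundaryDelta r s) atTop (𝓝 (boundaryDeltaLim r)) := by
  have hinv : Tendsto (fun s : ℝ => 1 / s) atTop (𝓝 0) := by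
    simpa using tendsto_inv_atTop_zero (𝕜 := ℝ)
  have hexp : Tendsto (fun s : ℝ => s * (r - 1) / (r * (s - 1))) atTop (𝓝 ((r - 1) / r)) := by
    have h : Tendsto (fun s : ℝ => (r - 1) / r / (1 - 1 / s)) atTop (𝓝 ((r - 1) / r / (1 - 0))) :=
      tendsto_const_nhds.div (hinv.const_sub 1) (by norm_num)
    rw [sub_zero, div_one] at h
    refine h.congr' ?_
    filter_upwards [eventually_gt_atTop 1] with s hs
    have : s - 1 ≠ 0 := by linarith
    have : s ≠ 0 := by linarith
    have : r ≠ 0 := by linarith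
    field_simp
  have hpow : Tendsto (fun s : ℝ => (r + 1) ^ (s * (r - 1) / (r * (s - 1)))) atTop
      (𝓝 ((r + 1) ^ ((r - 1) / r))) :=
    ((Real.continuous_const_rpow (by linarith : r + 1 ≠ 0)).tendsto _).comp hexp
  have hne : (r + 1) ^ ((r - 1) / r) - 1 ≠ 0 := by
    have := Real.one_lt_rpow (show 1 < r + 1 by linarith)
      (show 0 < (r - 1) / r from div_pos (by linarith) (by linarith))
    linarith
  have := (((tendsto_const_nhds (x := r - 1)).div (hpow.sub_const 1) hne).sub_const 1).add hinv
  rw [add_zero] at this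
  exact this

/-! ### Bounds on the Bayes factor for a given ratio of residual sums of squares -/

lemma one_add_rpow_le_chord {κ w₀ w : ℝ} (h0 : 0 ≤ κ) (h1 : κ ≤ 1) (hw₀ : 0 < w₀) (hw : w₀ ≤ w) :
    (1 + w) ^ κ ≤ 1 + w * (((1 + w₀) ^ κ - 1) / w₀) := by
  have hwp : 0 < w := by linarith
  have ha : 0 ≤ 1 - w₀ / w := by rw [sub_nonneg, div_le_one hwp]; exact hw
  have hc := (Real.concaveOn_rpow h0 h1).2 (show (1 : ℝ) ∈ Set.Ici 0 by simp)
    (show 1 + w ∈ Set.Ici 0 by simp only [Set.mem_Ici]; linarith) ha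
    (show 0 ≤ w₀ / w by positivity) (by ring)
  simp only [smul_eq_mul, Real.one_rpow, mul_one] at hc
  have e : 1 - w₀ / w + w₀ / w * (1 + w) = 1 + w₀ := by field_simp; ring
  rw [e] at hc
  have h2 : w₀ / w * ((1 + w) ^ κ - 1) ≤ (1 + w₀) ^ κ - 1 := by linarith
  have h3 := mul_le_mul_of_nonneg_left h2 (show 0 ≤ w / w₀ by positivity)
  have e3 : w / w₀ * (w₀ / w * ((1 + w) ^ κ - 1)) = (1 + w) ^ κ - 1 := by field_simp
  have e4 : w / w₀ * ((1 + w₀) ^ κ - 1) = w * (((1 + w₀) ^ κ - 1) / w₀) := by ring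
  linarith

lemma one_add_rpow_le {κ w : ℝ} (h0 : 0 ≤ κ) (h1 : κ ≤ 1) (hw : 0 ≤ w) :
    (1 + w) ^ κ ≤ 1 + κ * w :=
  rpow_one_add_le_one_add_mul_self (by linarith) h0 h1

/-- The chord bound leaves the margin `η w`, and `(1 + w) ^ κ ≤ 1 + w ≤ 2 w` turns it into a
relative gain of `η / 2`. -/
lemma bayesRatio_le {κ w₀ w η B : ℝ} (h0 : 0 ≤ κ) (h1 : κ ≤ 1) (hw₀ : 1 ≤ w₀) (hw : w₀ ≤ w)
    (hη : 0 ≤ η) (hB : ((1 + w₀) ^ κ - 1) / w₀ + η ≤ B) :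
    (1 + w) ^ κ / (1 + B * w) ≤ (1 + η / 2)⁻¹ := by
  have hc := one_add_rpow_le_chord h0 h1 (by linarith) hw
  have hX : (1 + w) ^ κ ≤ 1 + w := (one_add_rpow_le h0 h1 (by linarith)).trans (by nlinarith)
  have hX0 : 0 < (1 + w) ^ κ := Real.rpow_pos_of_pos (by linarith) _
  have hBw : (((1 + w₀) ^ κ - 1) / w₀ + η) * w ≤ B * w :=
    mul_le_mul_of_nonneg_right hB (by linarith)
  have hlow : (1 + w) ^ κ * (1 + η / 2) ≤ 1 + B * w := by nlinarith
  have hpos : 0 < 1 + B * w := lt_of_lt_of_le (by positivity) hlow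
  rw [div_le_iff₀ hpos, inv_mul_eq_div, le_div_iff₀ (by positivity)]
  exact hlow

/-- At `w = w₀` the margin is `η w₀`. Moving to `w ≤ w₀ (1 + η / 2)` costs at most half of it
because `B ≤ 1`, and `(1 + w₀) ^ κ ≤ 2 w₀` makes the other half a relative gain of `η / 4`. -/
lemma le_bayesRatio {κ w₀ w η B : ℝ} (h0 : 0 ≤ κ) (h1 : κ ≤ 1) (hw₀ : 1 ≤ w₀) (hw : w₀ ≤ w)
    (hη : 0 ≤ η) (hw' : w ≤ w₀ * (1 + η / 2)) (hB0 : 0 < B)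
    (hB : B ≤ ((1 + w₀) ^ κ - 1) / w₀ - η) :
    1 + η / 4 ≤ (1 + w) ^ κ / (1 + B * w) := by
  have hw0p : 0 < w₀ := by linarith
  have hX0 : (1 + w₀) ^ κ ≤ 1 + κ * w₀ := one_add_rpow_le h0 h1 (by linarith)
  have hmono : (1 + w₀) ^ κ ≤ (1 + w) ^ κ := Real.rpow_le_rpow (by linarith) (by linarith) h0
  have hB' : (B + η) * w₀ ≤ (1 + w₀) ^ κ - 1 := by
    rw [← le_div_iff₀ hw0p]; linarith
  have hB1 : B ≤ 1 := by nlinarith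
  have hwp : 0 < w := by linarith
  have hpos : 0 < 1 + B * w := by positivity
  rw [le_div_iff₀ hpos]
  refine le_trans ?_ hmono
  have h2 : 1 + B * w ≤ (1 + w₀) ^ κ - η * w₀ / 2 := by
    have := mul_le_mul_of_nonneg_left hw' hB0.le
    have h3 : B * (w₀ * (η / 2)) ≤ 1 * (w₀ * (η / 2)) :=
      mul_le_mul_of_nonneg_right hB1 (by positivity)
    nlinarith
  have h4 := mul_le_mul_of_nonneg_left h2 (show 0 ≤ 1 + η / 4 by positivity)
  refine h4.trans ?_
  have hX1 : (1 + w₀) ^ κ ≤ 2 * w₀ := by nlinarith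
  have : η / 4 * ((1 + w₀) ^ κ) ≤ η / 4 * (2 * w₀) := by gcongr
  nlinarith [mul_nonneg (mul_nonneg hη hη) hw0p.le]

lemma bayesIntegrand_eq {n P x B a d : ℝ} (hn : 0 < n) (hP : 0 < P) (hx : 0 < x) (hB : 0 ≤ B)
    (had : 0 < a + d) :
    P ^ (a / 2) * (x ^ a * (n + P * x ^ 2) ^ (d / 2) / (n * B + P * x ^ 2) ^ ((a + d) / 2)) =
      ((1 + n / (P * x ^ 2)) ^ (d / (a + d)) / (1 + B * (n / (P * x ^ 2)))) ^ ((a + d) / 2) := by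
  set V := P * x ^ 2 with hV
  have hVp : 0 < V := by positivity
  have e1 : n + V = V * (1 + n / V) := by field_simp; ring
  have e2 : n * B + V = V * (1 + B * (n / V)) := by field_simp; ring
  have h1 : 0 < 1 + n / V := by positivity
  have h2 : 0 < 1 + B * (n / V) := by positivity
  have e3 : V ^ (a / 2) = P ^ (a / 2) * x ^ a := by
    rw [hV, Real.mul_rpow hP.le (by positivity), ← Real.rpow_natCast, ← Real.rpow_mul hx.le]
    congr 2
    push_cast
    ring
  rw [e1, e2, Real.mul_rpow hVp.le h1.le, Real.mul_rpow hVp.le h2.le,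
    Real.div_rpow (by positivity) h2.le, ← Real.rpow_mul h1.le]
  have e4 : d / (a + d) * ((a + d) / 2) = d / 2 := by field_simp
  have e5 : V ^ ((a + d) / 2) = V ^ (a / 2) * V ^ (d / 2) := by
    rw [← Real.rpow_add hVp]; congr 1; ring
  rw [e4, e5, e3]
  have : V ^ (d / 2) ≠ 0 := (Real.rpow_pos_of_pos hVp _).ne'
  have : P ^ (a / 2) ≠ 0 := (Real.rpow_pos_of_pos hP _).ne'
  have : x ^ a ≠ 0 := (Real.rpow_pos_of_pos hx _).ne'
  field_simp

/-- The Bayes factor for intrinsic priors as a function of the ratio `B` of residual sums of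
squares. -/
noncomputable def bayesFactorOfRatio (n p i B : ℝ) : ℝ :=
  2 / Real.pi * (p + 1) ^ ((p - i) / 2) *
    ∫ φ in (0 : ℝ)..(Real.pi / 2),
      Real.sin φ ^ (p - i) * (n + (p + 1) * Real.sin φ ^ (2 : ℕ)) ^ ((n - p) / 2) /
        (n * B + (p + 1) * Real.sin φ ^ (2 : ℕ)) ^ ((n - i) / 2)

lemma intrinsicBayesFactor_eq {n i p : ℕ} (Xi : Matrix (Fin n) (Fin i) ℝ)
    (Xp : Matrix (Fin n) (Fin p) ℝ) (y : Fin n → ℝ) :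
    intrinsicBayesFactor Xi Xp y = bayesFactorOfRatio n p i (rssRatio Xi Xp y) := rfl

lemma bayesFactorOfRatio_eq (n p i B : ℝ) :
    bayesFactorOfRatio n p i B = 2 / Real.pi * ∫ φ in (0 : ℝ)..(Real.pi / 2),
      (p + 1) ^ ((p - i) / 2) *
      (Real.sin φ ^ (p - i) * (n + (p + 1) * Real.sin φ ^ (2 : ℕ)) ^ ((n - p) / 2) /
        (n * B + (p + 1) * Real.sin φ ^ (2 : ℕ)) ^ ((p - i + (n - p)) / 2)) := by
  rw [bayesFactorOfRatio, intervalIntegral.integral_const_mul, mul_assoc]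
  have : n - i = p - i + (n - p) := by ring
  rw [this]

lemma sin_pos_of_mem {φ : ℝ} (h : φ ∈ Set.Ioc 0 (Real.pi / 2)) : 0 < Real.sin φ :=
  Real.sin_pos_of_pos_of_lt_pi h.1 (by linarith [h.2, Real.pi_pos])

lemma div_mul_sin_sq {n P φ : ℝ} (hn : 0 < n) (hP : 0 < P) (h : 0 < Real.sin φ) :
    n / P ≤ n / (P * Real.sin φ ^ 2) := by
  have : P * Real.sin φ ^ 2 ≤ P * 1 :=
    mul_le_mul_of_nonneg_left (by nlinarith [Real.sin_le_one φ]) hP.le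
  exact div_le_div_of_nonneg_left hn.le (by positivity) (by linarith)

lemma abs_bayesFactorOfRatio_le {n p i B η : ℝ} (hn : 0 < n) (hp : 0 ≤ p) (hip : i < p)
    (hpn : p ≤ n) (hw : 1 ≤ n / (p + 1)) (hη : 0 ≤ η)
    (hB : ((1 + n / (p + 1)) ^ ((n - p) / (n - i)) - 1) / (n / (p + 1)) + η ≤ B) :
    |bayesFactorOfRatio n p i B| ≤ (1 + η / 2)⁻¹ ^ ((n - i) / 2) := by
  have hκ0 : 0 ≤ (n - p) / (n - i) := div_nonneg (by linarith) (by linarith)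
  have hκ1 : (n - p) / (n - i) ≤ 1 := (div_le_one (by linarith)).2 (by linarith)
  have hB0 : 0 ≤ B := by
    refine le_trans ?_ hB
    have := Real.one_le_rpow (show 1 ≤ 1 + n / (p + 1) by linarith) hκ0
    exact add_nonneg (div_nonneg (by linarith) (by linarith)) hη
  have e : p - i + (n - p) = n - i := by ring
  rw [bayesFactorOfRatio_eq, abs_mul, ← Real.norm_eq_abs (∫ _ in _.._, _)]
  have hbd := intervalIntegral.norm_integral_le_of_norm_le_const (a := (0 : ℝ)) (b := Real.pi / 2)
    (C := (1 + η / 2)⁻¹ ^ ((n - i) / 2)) (f := fun φ => (p + 1) ^ ((p - i) / 2) *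
      (Real.sin φ ^ (p - i) * (n + (p + 1) * Real.sin φ ^ (2 : ℕ)) ^ ((n - p) / 2) /
        (n * B + (p + 1) * Real.sin φ ^ (2 : ℕ)) ^ ((p - i + (n - p)) / 2))) (fun φ hφ => by
    rw [Set.uIoc_of_le (by positivity)] at hφ
    have hs := sin_pos_of_mem hφ
    have hp1 : 0 < p + 1 := by linarith
    rw [bayesIntegrand_eq hn hp1 hs hB0 (by linarith), e]
    have hr := bayesRatio_le hκ0 hκ1 hw (div_mul_sin_sq hn hp1 hs) hη hB
    have hr0 : 0 ≤ (1 + n / ((p + 1) * Real.sin φ ^ 2)) ^ ((n - p) / (n - i)) /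
        (1 + B * (n / ((p + 1) * Real.sin φ ^ 2))) := by positivity
    rw [Real.norm_eq_abs, abs_of_nonneg (Real.rpow_nonneg hr0 _)]
    exact Real.rpow_le_rpow hr0 hr (by linarith))
  rw [sub_zero, abs_of_pos (show 0 < Real.pi / 2 by positivity)] at hbd
  rw [abs_of_pos (show 0 < 2 / Real.pi by positivity)]
  refine (mul_le_mul_of_nonneg_left hbd (by positivity)).trans (le_of_eq ?_)
  have := Real.pi_ne_zero
  field_simp

/-- The integrand is nonnegative, so the integral is at least its part over `[π / 2 - γ, π / 2]`,
where `w` is close enough to `w₀` for `le_bayesRatio`. -/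
lemma le_bayesFactorOfRatio {n p i B η γ : ℝ} (hn : 0 < n) (hp : 0 ≤ p) (hip : i < p)
    (hpn : p ≤ n) (hw : 1 ≤ n / (p + 1)) (hη : 0 ≤ η) (hB0 : 0 < B)
    (hB : B ≤ ((1 + n / (p + 1)) ^ ((n - p) / (n - i)) - 1) / (n / (p + 1)) - η)
    (hγ0 : 0 < γ) (hγ1 : γ ≤ Real.pi / 2)
    (hγ : ∀ φ ∈ Set.Icc (Real.pi / 2 - γ) (Real.pi / 2), 1 ≤ Real.sin φ ^ 2 * (1 + η / 2)) :
    2 / Real.pi * (γ * (1 + η / 4) ^ ((n - i) / 2)) ≤ bayesFactorOfRatio n p i B := by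
  have hκ0 : 0 ≤ (n - p) / (n - i) := div_nonneg (by linarith) (by linarith)
  have hκ1 : (n - p) / (n - i) ≤ 1 := (div_le_one (by linarith)).2 (by linarith)
  have hp1 : 0 < p + 1 := by linarith
  have e : p - i + (n - p) = n - i := by ring
  rw [bayesFactorOfRatio_eq]
  refine mul_le_mul_of_nonneg_left ?_ (by positivity)
  set f : ℝ → ℝ := fun φ => (p + 1) ^ ((p - i) / 2) *
      (Real.sin φ ^ (p - i) * (n + (p + 1) * Real.sin φ ^ (2 : ℕ)) ^ ((n - p) / 2) /
        (n * B + (p + 1) * Real.sin φ ^ (2 : ℕ)) ^ ((p - i + (n - p)) / 2)) with hf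
  have hcont : Continuous f := by
    have hs : Continuous fun φ => Real.sin φ ^ (p - i) :=
      Real.continuous_sin.rpow_const fun _ => Or.inr (by linarith)
    have h1 : Continuous fun φ => (n + (p + 1) * Real.sin φ ^ (2 : ℕ)) ^ ((n - p) / 2) :=
      (by fun_prop : Continuous fun φ => n + (p + 1) * Real.sin φ ^ (2 : ℕ)).rpow_const
        fun φ => Or.inl (by positivity)
    have h2 : Continuous fun φ =>
        (n * B + (p + 1) * Real.sin φ ^ (2 : ℕ)) ^ ((p - i + (n - p)) / 2) :=
      (by fun_prop : Continuous fun φ => n * B + (p + 1) * Real.sin φ ^ (2 : ℕ)).rpow_const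
        fun φ => Or.inl (by positivity)
    exact continuous_const.mul ((hs.mul h1).div h2 fun φ =>
      (Real.rpow_pos_of_pos (by positivity) _).ne')
  have hnn : ∀ φ ∈ Set.Icc 0 (Real.pi / 2 - γ), 0 ≤ f φ := by
    intro φ hφ
    have hs : 0 ≤ Real.sin φ :=
      Real.sin_nonneg_of_nonneg_of_le_pi hφ.1 (by linarith [hφ.2, Real.pi_pos])
    positivity
  rw [← intervalIntegral.integral_add_adjacent_intervals
    (hcont.intervalIntegrable 0 (Real.pi / 2 - γ)) (hcont.intervalIntegrable _ (Real.pi / 2))]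
  have h1 : 0 ≤ ∫ φ in (0 : ℝ)..(Real.pi / 2 - γ), f φ :=
    intervalIntegral.integral_nonneg (by linarith) hnn
  have h2 : ∫ _ in (Real.pi / 2 - γ)..(Real.pi / 2), (1 + η / 4) ^ ((n - i) / 2) ≤
      ∫ φ in (Real.pi / 2 - γ)..(Real.pi / 2), f φ := by
    refine intervalIntegral.integral_mono_on_of_le_Ioo (by linarith) (by simp)
      (hcont.intervalIntegrable _ _) fun φ hφ => ?_
    have hs := sin_pos_of_mem (φ := φ) ⟨by linarith [hφ.1], hφ.2.le⟩
    simp only [hf]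
    rw [bayesIntegrand_eq hn hp1 hs hB0.le (by linarith), e]
    refine Real.rpow_le_rpow (by positivity) ?_ (by linarith)
    refine le_bayesRatio hκ0 hκ1 hw (div_mul_sin_sq hn hp1 hs) hη ?_ hB0 hB
    have := hγ φ ⟨hφ.1.le, hφ.2.le⟩
    rw [div_mul_eq_mul_div, div_le_div_iff₀ (by positivity) hp1]
    have h3 := mul_le_mul_of_nonneg_left this (show 0 ≤ n * (p + 1) by positivity)
    linarith
  rw [intervalIntegral.integral_const, sub_sub_cancel, smul_eq_mul] at h2
  linarith

/-! ### The critical ratio and the large-sample limits -/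

/-- The limiting value `((1 + r) ^ θ - 1) / r`, `θ = (1 - 1/r) / (1 - 1/s)`, of the ratio of
residual sums of squares at which the Bayes factor switches its limit. -/
noncomputable def criticalRatio (r s : ℝ) : ℝ :=
  ((1 + r) ^ ((1 - r⁻¹) / (1 - s⁻¹)) - 1) / r

lemma criticalRatio_pos {r s : ℝ} (hr : 1 < r) (hrs : r < s) : 0 < criticalRatio r s := by
  have h1 : 0 < 1 - r⁻¹ := sub_pos.2 (inv_lt_one_of_one_lt₀ hr)
  have h2 : 0 < 1 - s⁻¹ := sub_pos.2 (inv_lt_one_of_one_lt₀ (hr.trans hrs))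
  have := Real.one_lt_rpow (show 1 < 1 + r by linarith) (div_pos h1 h2)
  exact div_pos (by linarith) (by linarith)

/-- The boundary is the solution `δ` of `(1 - 1/r) / (1 - 1/s + δ) = criticalRatio r s`. -/
lemma boundaryDelta_eq_criticalRatio {r s : ℝ} (hr : 1 < r) (hrs : r < s) :
    boundaryDelta r s = (1 - r⁻¹) / criticalRatio r s - (1 - s⁻¹) := by
  have h0 := (criticalRatio_pos hr hrs).ne'
  have e : (1 - r⁻¹) / (1 - s⁻¹) = s * (r - 1) / (r * (s - 1)) := by
    have : s - 1 ≠ 0 := by linarith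
    have : s ≠ 0 := by linarith
    have : r ≠ 0 := by linarith
    field_simp
  rw [criticalRatio, e] at h0
  have hr0 : r ≠ 0 := by linarith
  have h1 : (1 + r) ^ (s * (r - 1) / (r * (s - 1))) - 1 ≠ 0 :=
    fun h => h0 (by rw [h, zero_div])
  rw [boundaryDelta, criticalRatio, e, add_comm r 1]
  field_simp
  ring

lemma tendsto_inv_ratio {k : ℕ → ℕ} {r : ℝ}
    (h : Tendsto (fun n : ℕ => (n : ℝ) / (k n : ℝ)) atTop (𝓝 r)) (hr : 1 < r) :
    Tendsto (fun n : ℕ => (k n : ℝ) / (n : ℝ)) atTop (𝓝 r⁻¹) := by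
  simpa using h.inv₀ (by linarith)

section Asymptotics

variable {i p : ℕ → ℕ} {r s : ℝ}

lemma eventually_lt_of_ratio {k l : ℕ → ℕ} {a b : ℝ}
    (hk : Tendsto (fun n : ℕ => (k n : ℝ) / (n : ℝ)) atTop (𝓝 a))
    (hl : Tendsto (fun n : ℕ => (l n : ℝ) / (n : ℝ)) atTop (𝓝 b)) (hab : a < b) :
    ∀ᶠ n in atTop, (k n : ℝ) < l n := by
  filter_upwards [hk.eventually_lt hl hab, eventually_gt_atTop 0] with n h hn
  have hn' : (0 : ℝ) < n := by exact_mod_cast hn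
  exact (div_lt_div_iff_of_pos_right hn').1 h

lemma tendsto_self_div_self : Tendsto (fun n : ℕ => ((fun n => n) n : ℝ) / (n : ℝ)) atTop (𝓝 1) := by
  refine tendsto_const_nhds.congr' ?_
  filter_upwards [eventually_gt_atTop 0] with n hn
  have hn' : (n : ℝ) ≠ 0 := by positivity
  exact (div_self hn').symm

lemma tendsto_div_add_one (hp : Tendsto (fun n : ℕ => (n : ℝ) / (p n : ℝ)) atTop (𝓝 r))
    (hr : 1 < r) : Tendsto (fun n : ℕ => (n : ℝ) / ((p n : ℝ) + 1)) atTop (𝓝 r) := by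
  have h := ((tendsto_inv_ratio hp hr).add (tendsto_one_div_atTop_nhds_zero_nat (𝕜 := ℝ))).inv₀
    (by rw [add_zero]; exact inv_ne_zero (by linarith))
  rw [add_zero, inv_inv] at h
  refine h.congr fun n => ?_
  rw [← add_div, inv_div]

lemma tendsto_exponent_ratio (hp : Tendsto (fun n : ℕ => (n : ℝ) / (p n : ℝ)) atTop (𝓝 r))
    (hi : Tendsto (fun n : ℕ => (n : ℝ) / (i n : ℝ)) atTop (𝓝 s)) (hr : 1 < r) (hrs : r < s) :
    Tendsto (fun n : ℕ => ((n : ℝ) - p n) / ((n : ℝ) - i n)) atTop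
      (𝓝 ((1 - r⁻¹) / (1 - s⁻¹))) := by
  have hs := hr.trans hrs
  have h := ((tendsto_inv_ratio hp hr).const_sub 1).div ((tendsto_inv_ratio hi hs).const_sub 1)
    (sub_pos.2 (inv_lt_one_of_one_lt₀ hs)).ne'
  refine h.congr' ?_
  filter_upwards [eventually_gt_atTop 0] with n hn
  have hn' : (n : ℝ) ≠ 0 := by positivity
  simp only [Pi.div_apply]
  rw [one_sub_div hn', one_sub_div hn', div_div_div_cancel_right₀ hn']

lemma tendsto_criticalRatio (hp : Tendsto (fun n : ℕ => (n : ℝ) / (p n : ℝ)) atTop (𝓝 r))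
    (hi : Tendsto (fun n : ℕ => (n : ℝ) / (i n : ℝ)) atTop (𝓝 s)) (hr : 1 < r) (hrs : r < s) :
    Tendsto (fun n : ℕ => ((1 + (n : ℝ) / ((p n : ℝ) + 1)) ^
      (((n : ℝ) - p n) / ((n : ℝ) - i n)) - 1) / ((n : ℝ) / ((p n : ℝ) + 1))) atTop
      (𝓝 (criticalRatio r s)) := by
  have hw := tendsto_div_add_one hp hr
  exact (((hw.const_add 1).rpow (tendsto_exponent_ratio hp hi hr hrs)
    (Or.inl (by linarith))).sub_const 1).div hw (by linarith)

lemma tendsto_half_sub_atTop (hi : Tendsto (fun n : ℕ => (n : ℝ) / (i n : ℝ)) atTop (𝓝 s))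
    (hs : 1 < s) : Tendsto (fun n : ℕ => ((n : ℝ) - i n) / 2) atTop atTop := by
  have h := (tendsto_natCast_atTop_atTop (R := ℝ)).atTop_mul_pos
    (div_pos (sub_pos.2 (inv_lt_one_of_one_lt₀ hs)) two_pos)
    (((tendsto_inv_ratio hi hs).const_sub 1).div_const 2)
  refine h.congr' ?_
  filter_upwards [eventually_gt_atTop 0] with n hn
  have hn' : (n : ℝ) ≠ 0 := by positivity
  field_simp

lemma eventually_dimensions (hp : Tendsto (fun n : ℕ => (n : ℝ) / (p n : ℝ)) atTop (𝓝 r))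
    (hi : Tendsto (fun n : ℕ => (n : ℝ) / (i n : ℝ)) atTop (𝓝 s)) (hr : 1 < r) (hrs : r < s) :
    ∀ᶠ n : ℕ in atTop, (0 : ℝ) < n ∧ (i n : ℝ) < p n ∧ (p n : ℝ) < n ∧
      1 ≤ (n : ℝ) / ((p n : ℝ) + 1) := by
  have hs := hr.trans hrs
  filter_upwards [eventually_gt_atTop 0,
    eventually_lt_of_ratio (tendsto_inv_ratio hi hs) (tendsto_inv_ratio hp hr)
      (inv_strictAnti₀ (by linarith) hrs),
    eventually_lt_of_ratio (tendsto_inv_ratio hp hr) tendsto_self_div_self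
      (inv_lt_one_of_one_lt₀ hr),
    (tendsto_div_add_one hp hr).eventually (lt_mem_nhds hr)] with n h1 h2 h3 h4
  exact ⟨by exact_mod_cast h1, h2, h3, h4.le⟩

lemma eventually_abs_bayesFactorOfRatio_lt
    (hp : Tendsto (fun n : ℕ => (n : ℝ) / (p n : ℝ)) atTop (𝓝 r))
    (hi : Tendsto (fun n : ℕ => (n : ℝ) / (i n : ℝ)) atTop (𝓝 s)) (hr : 1 < r) (hrs : r < s)
    {b : ℝ} (hb : criticalRatio r s < b) {ε : ℝ} (hε : 0 < ε) :
    ∀ᶠ n : ℕ in atTop, ∀ B : ℝ, b ≤ B → |bayesFactorOfRatio n (p n) (i n) B| < ε := by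
  obtain ⟨c, hc1, hc2⟩ := exists_between hb
  have hη : 0 < b - c := by linarith
  have hlim : Tendsto (fun n : ℕ => (1 + (b - c) / 2)⁻¹ ^ (((n : ℝ) - i n) / 2)) atTop (𝓝 0) :=
    (tendsto_rpow_atTop_of_base_lt_one _ (by
      have : 0 < (1 + (b - c) / 2)⁻¹ := by positivity
      linarith) (inv_lt_one_of_one_lt₀ (by linarith))).comp
      (tendsto_half_sub_atTop hi (hr.trans hrs))
  filter_upwards [eventually_dimensions hp hi hr hrs, hlim.eventually (gt_mem_nhds hε),
    (tendsto_criticalRatio hp hi hr hrs).eventually (gt_mem_nhds hc1)] with n hd hlt hcr B hB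
  obtain ⟨hn, hip, hpn, hw⟩ := hd
  exact (abs_bayesFactorOfRatio_le hn (Nat.cast_nonneg _) hip hpn.le hw hη.le
    (by linarith)).trans_lt hlt

lemma eventually_lt_bayesFactorOfRatio
    (hp : Tendsto (fun n : ℕ => (n : ℝ) / (p n : ℝ)) atTop (𝓝 r))
    (hi : Tendsto (fun n : ℕ => (n : ℝ) / (i n : ℝ)) atTop (𝓝 s)) (hr : 1 < r) (hrs : r < s)
    {b : ℝ} (hb : b < criticalRatio r s) (K : ℝ) :
    ∀ᶠ n : ℕ in atTop, ∀ B : ℝ, 0 < B → B ≤ b → K < bayesFactorOfRatio n (p n) (i n) B := by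
  obtain ⟨c, hc1, hc2⟩ := exists_between hb
  have hη : 0 < c - b := by linarith
  -- The width `γ` depends only on the margin `c - b`, not on `n`, so the exponential growth
  -- survives the factor `γ`.
  obtain ⟨γ, hγ0, hγ1, hγ⟩ : ∃ γ : ℝ, 0 < γ ∧ γ ≤ Real.pi / 2 ∧
      ∀ φ ∈ Set.Icc (Real.pi / 2 - γ) (Real.pi / 2), 1 ≤ Real.sin φ ^ 2 * (1 + (c - b) / 2) := by
    have hcont : ContinuousAt (fun φ => Real.sin φ ^ 2 * (1 + (c - b) / 2)) (Real.pi / 2) := by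
      fun_prop
    have hev := hcont.eventually (lt_mem_nhds (a := 1) (by simp; linarith))
    obtain ⟨e, he, hball⟩ := Metric.eventually_nhds_iff.1 hev
    refine ⟨min (e / 2) (Real.pi / 2), by positivity, min_le_right _ _, fun φ hφ => ?_⟩
    refine (hball ?_).le
    rw [Real.dist_eq, abs_sub_comm, abs_of_nonneg (by linarith [hφ.2])]
    linarith [hφ.1, min_le_left (e / 2) (Real.pi / 2)]
  have hlim : Tendsto (fun n : ℕ => 2 / Real.pi *
      (γ * (1 + (c - b) / 4) ^ (((n : ℝ) - i n) / 2))) atTop atTop :=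
    (((tendsto_rpow_atTop_of_base_gt_one _ (by linarith)).comp
      (tendsto_half_sub_atTop hi (hr.trans hrs))).const_mul_atTop hγ0).const_mul_atTop
      (by positivity)
  filter_upwards [eventually_dimensions hp hi hr hrs, hlim.eventually (eventually_gt_atTop K),
    (tendsto_criticalRatio hp hi hr hrs).eventually (lt_mem_nhds hc2)] with n hd hlt hcr B hB0 hB
  obtain ⟨hn, hip, hpn, hw⟩ := hd
  exact hlt.trans_le (le_bayesFactorOfRatio hn (Nat.cast_nonneg _) hip hpn.le hw hη.le hB0
    (by linarith) hγ0 hγ1 hγ)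

end Asymptotics

/-! ### Chebyshev bounds for Gaussian linear and quadratic forms -/

/-- The standard Gaussian measure on `Fin n → ℝ`. -/
noncomputable def stdNormalVec (n : ℕ) : Measure (Fin n → ℝ) :=
  Measure.pi fun _ => gaussianReal 0 1

instance (n : ℕ) : IsProbabilityMeasure (stdNormalVec n) := by
  unfold stdNormalVec; infer_instance

lemma linearModel_eq_map {n k : ℕ} (X : Matrix (Fin n) (Fin k) ℝ) (b : Fin k → ℝ) (σ : ℝ) :
    linearModel X b σ = (stdNormalVec n).map fun ε => X *ᵥ b + σ • ε := by
  have h := Measure.pi_map_pi (μ := fun _ : Fin n => gaussianReal 0 1)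
    (f := fun j x => (X *ᵥ b) j + σ * x) (fun j => by fun_prop)
  have e : ∀ j, (gaussianReal 0 1).map (fun x => (X *ᵥ b) j + σ * x) =
      gaussianReal ((X *ᵥ b) j) (σ ^ 2).toNNReal := by
    intro j
    have : (fun x => (X *ᵥ b) j + σ * x) = (fun x => (X *ᵥ b) j + x) ∘ (fun x => σ * x) := rfl
    rw [this, ← Measure.map_map (by fun_prop) (by fun_prop), gaussianReal_map_const_mul,
      gaussianReal_map_const_add]
    congr 1
    · ring
    · ext
      simp [Real.coe_toNNReal _ (sq_nonneg σ)]
  simp_rw [e] at h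
  exact h.symm

/-- The variance of the square of a standard normal variable. -/
noncomputable def sqVariance : ℝ := Var[fun x : ℝ => x ^ 2; gaussianReal 0 1]

lemma memLp_sq_gaussianReal : MemLp (fun x : ℝ => x ^ 2) 2 (gaussianReal 0 1) := by
  have h := memLp_id_gaussianReal' (μ := 0) (v := 1) 4 (by norm_num)
  have h4 : MemLp (fun x : ℝ => x * x) 2 (gaussianReal 0 1) := by
    have : ENNReal.HolderTriple 4 4 2 := ⟨by
      rw [show (4 : ENNReal) = 2 * 2 by norm_num, ENNReal.mul_inv (by simp) (by simp),
        ← mul_add, ENNReal.inv_two_add_inv_two, mul_one]⟩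
    exact h.mul h
  simpa [sq] using h4

lemma integral_sq_gaussianReal : ∫ x : ℝ, x ^ 2 ∂(gaussianReal 0 1) = 1 := by
  have h := variance_eq_sub (memLp_id_gaussianReal' (μ := 0) (v := 1) 2 (by norm_num))
  rw [variance_id_gaussianReal] at h
  simp only [Pi.pow_apply, id, integral_id_gaussianReal] at h
  simpa using h.symm

lemma stdNormalVec_tail_sum {n : ℕ} (f : Fin n → ℝ → ℝ)
    (hf : ∀ j, MemLp (f j) 2 (gaussianReal 0 1)) {c : ℝ} (hc : 0 < c) :
    stdNormalVec n {z | c ≤ |∑ j, f j (z j) - ∑ j, ∫ x, f j x ∂(gaussianReal 0 1)|} ≤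
      ENNReal.ofReal ((∑ j, Var[f j; gaussianReal 0 1]) / c ^ 2) := by
  unfold stdNormalVec
  have hm : ∀ j, MemLp (fun z : Fin n → ℝ => f j (z j)) 2 (Measure.pi fun _ : Fin n => gaussianReal 0 1) := fun j =>
    (hf j).comp_measurePreserving (measurePreserving_eval (fun _ : Fin n => gaussianReal 0 1) j)
  have hsum : MemLp (∑ j, fun z : Fin n → ℝ => f j (z j)) 2 (Measure.pi fun _ : Fin n => gaussianReal 0 1) :=
    memLp_finsetSum' _ fun j _ => hm j
  have h := meas_ge_le_variance_div_sq hsum hc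
  rw [variance_sum_pi hf] at h
  have e : ∫ z, (∑ j, fun z : Fin n → ℝ => f j (z j)) z ∂(Measure.pi fun _ => gaussianReal 0 1) =
      ∑ j, ∫ x, f j x ∂(gaussianReal 0 1) := by
    simp only [Finset.sum_apply]
    rw [integral_finsetSum _ fun j _ => (hm j).integrable (by norm_num)]
    exact Finset.sum_congr rfl fun j _ => integral_comp_eval (hf j).aestronglyMeasurable
  rw [e] at h
  simpa only [Finset.sum_apply] using h

lemma stdNormalVec_tail_linear {n : ℕ} (a : Fin n → ℝ) {c : ℝ} (hc : 0 < c) :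
    stdNormalVec n {z | c ≤ |a ⬝ᵥ z|} ≤ ENNReal.ofReal (a ⬝ᵥ a / c ^ 2) := by
  have h := stdNormalVec_tail_sum (fun j x => a j * x)
    (fun j => (memLp_id_gaussianReal' (μ := 0) (v := 1) 2 (by norm_num)).const_mul (a j)) hc
  have e1 : ∀ j : Fin n, ∫ x : ℝ, a j * x ∂(gaussianReal 0 1) = 0 := by
    intro j
    rw [integral_const_mul, integral_id_gaussianReal, mul_zero]
  have e2 : ∀ j : Fin n, Var[fun x : ℝ => a j * x; gaussianReal 0 1] = a j * a j := by
    intro j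
    rw [variance_const_mul, variance_fun_id_gaussianReal]
    simp [sq]
  simp only [e1, e2, Finset.sum_const_zero, sub_zero] at h
  exact h

/-- Rotation invariance, used to diagonalise quadratic forms without changing the law. -/
lemma stdNormalVec_map_eigenbasis {n : ℕ}
    (b : OrthonormalBasis (Fin n) ℝ (EuclideanSpace ℝ (Fin n))) :
    (stdNormalVec n).map (fun z => (∑ j, z j • b j).ofLp) = stdNormalVec n := by
  have h1 := map_pi_eq_stdGaussian (ι := Fin n)
  rw [stdGaussian_eq_map_pi_orthonormalBasis b] at h1
  have h2 := congrArg (Measure.map (WithLp.ofLp : EuclideanSpace ℝ (Fin n) → Fin n → ℝ)) h1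
  rw [Measure.map_map (by fun_prop) (by fun_prop),
    Measure.map_map (by fun_prop) (by fun_prop)] at h2
  have e : (WithLp.ofLp : EuclideanSpace ℝ (Fin n) → Fin n → ℝ) ∘ WithLp.toLp 2 = id := rfl
  rw [e, Measure.map_id] at h2
  exact h2.symm

lemma quadForm_eigenbasis {n : ℕ} {A : Matrix (Fin n) (Fin n) ℝ} (hA : A.IsHermitian)
    (z : Fin n → ℝ) :
    (∑ j, z j • hA.eigenvectorBasis j).ofLp ⬝ᵥ (A *ᵥ (∑ j, z j • hA.eigenvectorBasis j).ofLp) =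
      ∑ j, hA.eigenvalues j * z j ^ 2 := by
  have e1 : A *ᵥ (∑ j, z j • hA.eigenvectorBasis j).ofLp =
      (∑ j, (hA.eigenvalues j * z j) • hA.eigenvectorBasis j).ofLp := by
    simp only [WithLp.ofLp_sum, WithLp.ofLp_smul, Matrix.mulVec_sum, Matrix.mulVec_smul,
      hA.mulVec_eigenvectorBasis, smul_smul]
    exact Finset.sum_congr rfl fun j _ => by rw [mul_comm]
  have h := hA.eigenvectorBasis.orthonormal.inner_sum (fun j => hA.eigenvalues j * z j) z
    Finset.univ
  rw [EuclideanSpace.inner_eq_star_dotProduct] at h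
  rw [e1]
  simp only [star_trivial, conj_trivial] at h
  rw [h]
  exact Finset.sum_congr rfl fun j _ => by ring

lemma eigenvalues_sq_of_idempotent {n : ℕ} {A : Matrix (Fin n) (Fin n) ℝ} (hA : A.IsHermitian)
    (hAA : A * A = A) (j : Fin n) : hA.eigenvalues j ^ 2 = hA.eigenvalues j := by
  have h := hA.mulVec_eigenvectorBasis j
  have h2 : A *ᵥ (A *ᵥ (hA.eigenvectorBasis j).ofLp) = A *ᵥ (hA.eigenvectorBasis j).ofLp := by
    rw [Matrix.mulVec_mulVec, hAA]
  rw [h, Matrix.mulVec_smul, h, smul_smul] at h2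
  have hne : (hA.eigenvectorBasis j).ofLp ≠ 0 := by
    intro h0
    exact hA.eigenvectorBasis.orthonormal.ne_zero j (WithLp.ofLp_injective 2 h0)
  have := smul_left_injective ℝ hne h2
  rw [sq]
  exact this

/-- In an eigenbasis the form is `∑ λ_j z_j²` with `λ_j² = λ_j`, so its mean is the trace and its
variance is `sqVariance` times the trace. The value of `sqVariance` is immaterial. -/
lemma stdNormalVec_tail_quadForm {n : ℕ} {A : Matrix (Fin n) (Fin n) ℝ} (hA : A.IsHermitian)
    (hAA : A * A = A) {c : ℝ} (hc : 0 < c) :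
    stdNormalVec n {z | c ≤ |z ⬝ᵥ (A *ᵥ z) - A.trace|} ≤
      ENNReal.ofReal (sqVariance * A.trace / c ^ 2) := by
  have htr : A.trace = ∑ j, hA.eigenvalues j := by simpa using hA.trace_eq_sum_eigenvalues
  have h := stdNormalVec_tail_sum (fun j x => hA.eigenvalues j * x ^ 2)
    (fun j => memLp_sq_gaussianReal.const_mul _) hc
  simp only [integral_const_mul, integral_sq_gaussianReal, mul_one, variance_const_mul,
    eigenvalues_sq_of_idempotent hA hAA, ← Finset.sum_mul, ← htr] at h
  rw [mul_comm]
  have hmeas : MeasurableSet {z : Fin n → ℝ | c ≤ |z ⬝ᵥ (A *ᵥ z) - A.trace|} := by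
    have : Continuous fun z : Fin n → ℝ => |z ⬝ᵥ (A *ᵥ z) - A.trace| :=
      ((continuous_id.dotProduct (continuous_const.matrix_mulVec continuous_id)).sub
        continuous_const).abs
    exact measurableSet_le measurable_const this.measurable
  rw [← stdNormalVec_map_eigenbasis hA.eigenvectorBasis, Measure.map_apply (by fun_prop) hmeas]
  refine le_trans (le_of_eq ?_) h
  congr 1
  ext z
  simp only [Set.mem_preimage, Set.mem_ofPred_eq, quadForm_eigenbasis]

/-- Concentration of the normalised residual sum of squares in a Gaussian linear model. -/
lemma linearModel_tail_quadForm {n k : ℕ} {A : Matrix (Fin n) (Fin n) ℝ} (hA : A.IsHermitian)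
    (hAA : A * A = A) (X : Matrix (Fin n) (Fin k) ℝ) (b : Fin k → ℝ) {σ τ δ : ℝ} (hσ : 0 < σ)
    (hτ : 0 < τ) (hn : 0 < n) (htr : A.trace ≤ n)
    (hδ : (X *ᵥ b) ⬝ᵥ (A *ᵥ (X *ᵥ b)) = n * σ ^ 2 * δ) :
    linearModel X b σ {y | τ * (1 + δ) < |y ⬝ᵥ (A *ᵥ y) / (n * σ ^ 2) - (A.trace / n + δ)|} ≤
      ENNReal.ofReal ((4 * sqVariance + 16) / (n * τ ^ 2)) := by
  have hn' : (0 : ℝ) < n := by exact_mod_cast hn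
  set m := X *ᵥ b with hm
  have hAt : Aᵀ = A := by
    rw [← Matrix.conjTranspose_eq_transpose_of_trivial]; exact hA.eq
  have hsym : ∀ u v : Fin n → ℝ, u ⬝ᵥ (A *ᵥ v) = (A *ᵥ u) ⬝ᵥ v := by
    intro u v
    rw [Matrix.dotProduct_mulVec, ← Matrix.mulVec_transpose, hAt]
  have hAm : (A *ᵥ m) ⬝ᵥ (A *ᵥ m) = n * σ ^ 2 * δ := by
    rw [← hsym, Matrix.mulVec_mulVec, hAA, hδ]
  have hδ0 : 0 ≤ δ := by
    have h1 : 0 ≤ (A *ᵥ m) ⬝ᵥ (A *ᵥ m) := Finset.sum_nonneg fun j _ => mul_self_nonneg _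
    rw [hAm] at h1
    exact nonneg_of_mul_nonneg_right h1 (by positivity)
  have hexp : ∀ ε : Fin n → ℝ, (m + σ • ε) ⬝ᵥ (A *ᵥ (m + σ • ε)) / (n * σ ^ 2) -
      (A.trace / n + δ) = (ε ⬝ᵥ (A *ᵥ ε) - A.trace) / n + 2 * ((A *ᵥ m) ⬝ᵥ ε) / (n * σ) := by
    intro ε
    have e : (m + σ • ε) ⬝ᵥ (A *ᵥ (m + σ • ε)) =
        n * σ ^ 2 * δ + 2 * σ * ((A *ᵥ m) ⬝ᵥ ε) + σ ^ 2 * (ε ⬝ᵥ (A *ᵥ ε)) := by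
      rw [Matrix.mulVec_add, Matrix.mulVec_smul, dotProduct_add, add_dotProduct, add_dotProduct,
        hδ, smul_dotProduct, dotProduct_smul, smul_dotProduct, dotProduct_smul, hsym m ε,
        dotProduct_comm ε (A *ᵥ m)]
      simp only [smul_eq_mul]
      ring
    rw [e]
    field_simp
    ring
  have hcont : Continuous fun y : Fin n → ℝ =>
      |y ⬝ᵥ (A *ᵥ y) / (n * σ ^ 2) - (A.trace / n + δ)| :=
    (((continuous_id.dotProduct (continuous_const.matrix_mulVec continuous_id)).div_const _).sub
        continuous_const).abs
  rw [linearModel_eq_map, Measure.map_apply (by fun_prop)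
    (measurableSet_lt measurable_const hcont.measurable)]
  -- The error splits into the noise's quadratic form and the cross term with the mean; each
  -- threshold allots at most half of `τ (1 + δ)`.
  have hc1 : 0 < n * τ / 2 := by positivity
  have hc2 : 0 < n * σ * τ * (1 + δ) / 4 := by positivity
  have hsub : ((fun ε => m + σ • ε) ⁻¹'
      {y | τ * (1 + δ) < |y ⬝ᵥ (A *ᵥ y) / (n * σ ^ 2) - (A.trace / n + δ)|}) ⊆
      {z | n * τ / 2 ≤ |z ⬝ᵥ (A *ᵥ z) - A.trace|} ∪
        {z | n * σ * τ * (1 + δ) / 4 ≤ |(A *ᵥ m) ⬝ᵥ z|} := by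
    intro ε hε
    simp only [Set.mem_preimage, Set.mem_ofPred_eq, hexp] at hε
    by_contra hcon
    simp only [Set.mem_union, Set.mem_ofPred_eq, not_or, not_le] at hcon
    have h1 : |(ε ⬝ᵥ (A *ᵥ ε) - A.trace) / n| ≤ τ / 2 := by
      rw [abs_div, abs_of_pos hn', div_le_iff₀ hn']
      linarith [hcon.1]
    have h2 : |2 * ((A *ᵥ m) ⬝ᵥ ε) / (n * σ)| ≤ τ * (1 + δ) / 2 := by
      rw [abs_div, abs_of_pos (show 0 < n * σ by positivity), abs_mul, abs_two,
        div_le_iff₀ (by positivity)]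
      linarith [hcon.2]
    have h3 := abs_add_le ((ε ⬝ᵥ (A *ᵥ ε) - A.trace) / n) (2 * ((A *ᵥ m) ⬝ᵥ ε) / (n * σ))
    nlinarith
  refine (measure_mono hsub).trans ((measure_union_le _ _).trans ?_)
  refine (add_le_add (stdNormalVec_tail_quadForm hA hAA hc1)
    (stdNormalVec_tail_linear (A *ᵥ m) hc2)).trans ?_
  have hV : 0 ≤ sqVariance := variance_nonneg _ _
  have htr0 : 0 ≤ A.trace := by
    rw [show A.trace = ∑ j, hA.eigenvalues j by simpa using hA.trace_eq_sum_eigenvalues]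
    exact Finset.sum_nonneg fun j _ => by
      rw [← eigenvalues_sq_of_idempotent hA hAA]; exact sq_nonneg _
  rw [← ENNReal.ofReal_add (by positivity) (by rw [hAm]; positivity), hAm]
  refine ENNReal.ofReal_le_ofReal ?_
  have h1 : sqVariance * A.trace / (n * τ / 2) ^ 2 ≤ 4 * sqVariance / (n * τ ^ 2) := by
    have : sqVariance * A.trace / (n * τ / 2) ^ 2 ≤ sqVariance * n / (n * τ / 2) ^ 2 := by gcongr
    refine this.trans (le_of_eq ?_)
    field_simp
    ring
  -- The cross term has variance proportional to `δ`, and `δ ≤ (1 + δ) ^ 2`. Measuring the error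
  -- relative to `1 + δ` thus makes the bound uniform in `δ`, as needed when the distances are
  -- unbounded.
  have h2 : n * σ ^ 2 * δ / (n * σ * τ * (1 + δ) / 4) ^ 2 ≤ 16 / (n * τ ^ 2) := by
    rw [div_le_div_iff₀ (by positivity) (by positivity)]
    have : δ ≤ (1 + δ) ^ 2 := by nlinarith
    have h3 := mul_le_mul_of_nonneg_left this (show 0 ≤ n ^ 2 * σ ^ 2 * τ ^ 2 by positivity)
    nlinarith
  rw [add_div]
  exact add_le_add h1 h2

/-! ### Projection algebra of hat matrices and residual sums of squares -/

section HatMatrix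

variable {n k : ℕ} {X : Matrix (Fin n) (Fin k) ℝ}

lemma linearIndependent_col_iff_rank : LinearIndependent ℝ X.col ↔ X.rank = k := by
  rw [linearIndependent_iff_card_eq_finrank_span, Set.finrank, ← Matrix.rank_eq_finrank_span_cols,
    Fintype.card_fin, eq_comm]

lemma rank_submatrix_embedding {i : ℕ} (hX : X.rank = k) (e : Fin i ↪ Fin k) :
    (X.submatrix id e).rank = i :=
  linearIndependent_col_iff_rank.1 ((linearIndependent_col_iff_rank.2 hX).comp e e.injective)

lemma isUnit_det_gram (hX : X.rank = k) : IsUnit (Xᵀ * X).det := by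
  rw [← Matrix.isUnit_iff_isUnit_det, ← Matrix.linearIndependent_cols_iff_isUnit,
    linearIndependent_col_iff_rank, Matrix.rank_transpose_mul_self, hX]

lemma hatMatrix_mul_self (hX : X.rank = k) : hatMatrix X * X = X := by
  rw [hatMatrix, Matrix.mul_assoc, Matrix.mul_assoc, Matrix.nonsing_inv_mul _ (isUnit_det_gram hX),
    Matrix.mul_one]

lemma hatMatrix_idempotent (hX : X.rank = k) : hatMatrix X * hatMatrix X = hatMatrix X := by
  have h : hatMatrix X * (X * (Xᵀ * X)⁻¹ * Xᵀ) = X * (Xᵀ * X)⁻¹ * Xᵀ := by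
    rw [← Matrix.mul_assoc, ← Matrix.mul_assoc, hatMatrix_mul_self hX]
  exact h

lemma trace_hatMatrix (hX : X.rank = k) : (hatMatrix X).trace = k := by
  rw [hatMatrix, Matrix.mul_assoc, Matrix.trace_mul_comm, Matrix.mul_assoc,
    Matrix.nonsing_inv_mul _ (isUnit_det_gram hX), Matrix.trace_one, Fintype.card_fin]

lemma transpose_hatMatrix : (hatMatrix X)ᵀ = hatMatrix X := by
  simp [hatMatrix, Matrix.transpose_mul, Matrix.transpose_nonsing_inv, Matrix.mul_assoc]

lemma isHermitian_one_sub_hatMatrix : (1 - hatMatrix X).IsHermitian := by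
  rw [Matrix.IsHermitian, Matrix.conjTranspose_eq_transpose_of_trivial, Matrix.transpose_sub,
    Matrix.transpose_one, transpose_hatMatrix]

lemma one_sub_hatMatrix_idempotent (hX : X.rank = k) :
    (1 - hatMatrix X) * (1 - hatMatrix X) = 1 - hatMatrix X := by
  rw [mul_sub, sub_mul, sub_mul, hatMatrix_idempotent hX]
  simp

lemma trace_one_sub_hatMatrix (hX : X.rank = k) : (1 - hatMatrix X).trace = (n : ℝ) - k := by
  rw [Matrix.trace_sub, trace_hatMatrix hX, Matrix.trace_one, Fintype.card_fin]

lemma one_sub_hatMatrix_mulVec (hX : X.rank = k) (b : Fin k → ℝ) :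
    (1 - hatMatrix X) *ᵥ (X *ᵥ b) = 0 := by
  rw [Matrix.mulVec_mulVec, Matrix.sub_mul, hatMatrix_mul_self hX, Matrix.one_mul, sub_self,
    Matrix.zero_mulVec]

lemma modelDistance_eq {i : ℕ} (Xi : Matrix (Fin n) (Fin i) ℝ) (b : Fin k → ℝ) (σ : ℝ) :
    modelDistance Xi X b σ =
      (X *ᵥ b) ⬝ᵥ ((1 - hatMatrix Xi) *ᵥ (X *ᵥ b)) / (n * σ ^ 2) := by
  have e : b ⬝ᵥ ((Xᵀ * (1 - hatMatrix Xi) * X) *ᵥ b) =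
      (X *ᵥ b) ⬝ᵥ ((1 - hatMatrix Xi) *ᵥ (X *ᵥ b)) := by
    rw [← Matrix.mulVec_mulVec, ← Matrix.mulVec_mulVec, Matrix.dotProduct_mulVec,
      Matrix.vecMul_transpose]
  rw [modelDistance, Matrix.smul_mulVec, dotProduct_smul, e, smul_eq_mul]
  ring

lemma modelDistance_nonneg {i : ℕ} {Xi : Matrix (Fin n) (Fin i) ℝ} (hXi : Xi.rank = i)
    (b : Fin k → ℝ) (σ : ℝ) : 0 ≤ modelDistance Xi X b σ := by
  rw [modelDistance_eq, ← one_sub_hatMatrix_idempotent hXi, ← Matrix.mulVec_mulVec,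
    Matrix.dotProduct_mulVec, ← Matrix.mulVec_transpose,
    ← Matrix.conjTranspose_eq_transpose_of_trivial, isHermitian_one_sub_hatMatrix.eq]
  exact div_nonneg (Finset.sum_nonneg fun j _ => mul_self_nonneg _) (by positivity)

/-- Joint concentration of the two normalised residual sums of squares under the full model. -/
lemma linearModel_tail_residualSS {i : ℕ} {Xi : Matrix (Fin n) (Fin i) ℝ} (hX : X.rank = k)
    (hXi : Xi.rank = i) (b : Fin k → ℝ) {σ τ : ℝ} (hσ : 0 < σ) (hτ : 0 < τ) (hn : 0 < n) :
    linearModel X b σ {y | ¬ (|residualSS X y / (n * σ ^ 2) - ((n : ℝ) - k) / n| ≤ τ ∧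
        |residualSS Xi y / (n * σ ^ 2) - (((n : ℝ) - i) / n + modelDistance Xi X b σ)| ≤
          τ * (1 + modelDistance Xi X b σ))} ≤
      ENNReal.ofReal ((4 * sqVariance + 16) / (n * τ ^ 2)) +
        ENNReal.ofReal ((4 * sqVariance + 16) / (n * τ ^ 2)) := by
  have hn' : (0 : ℝ) < n := by exact_mod_cast hn
  have h1 := linearModel_tail_quadForm isHermitian_one_sub_hatMatrix
    (one_sub_hatMatrix_idempotent hX) X b (δ := 0) hσ hτ hn
    (by rw [trace_one_sub_hatMatrix hX]; linarith [Nat.cast_nonneg (α := ℝ) k])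
    (by rw [one_sub_hatMatrix_mulVec hX, dotProduct_zero, mul_zero])
  have h2 := linearModel_tail_quadForm isHermitian_one_sub_hatMatrix
    (one_sub_hatMatrix_idempotent hXi) X b (δ := modelDistance Xi X b σ) hσ hτ hn
    (by rw [trace_one_sub_hatMatrix hXi]; linarith [Nat.cast_nonneg (α := ℝ) i])
    (by rw [modelDistance_eq]; field_simp)
  rw [trace_one_sub_hatMatrix hX, add_zero, add_zero, mul_one] at h1
  rw [trace_one_sub_hatMatrix hXi] at h2
  refine le_trans (measure_mono ?_) ((measure_union_le _ _).trans (add_le_add h1 h2))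
  intro y hy
  simp only [Set.mem_ofPred_eq, not_and_or, not_le] at hy
  exact hy

end HatMatrix

/-! ### Limits in probability under the full model -/

lemma rssRatio_eq_normalized {n i p : ℕ} (Xi : Matrix (Fin n) (Fin i) ℝ)
    (Xp : Matrix (Fin n) (Fin p) ℝ) (y : Fin n → ℝ) {c : ℝ} (hc : c ≠ 0) :
    rssRatio Xi Xp y = residualSS Xp y / c / (residualSS Xi y / c) := by
  rw [div_div_div_cancel_right₀ hc, rssRatio]

section FullModel

variable {i p : ℕ → ℕ} {r s : ℝ} {Xi : ∀ n : ℕ, Matrix (Fin n) (Fin (i n)) ℝ}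
  {X : ∀ n : ℕ, Matrix (Fin n) (Fin (p n)) ℝ} {β : ∀ n : ℕ, Fin (p n) → ℝ} {σ : ℕ → ℝ}

/-- The concentration event fails with probability `O(1 / n)`, so only a deterministic check on that
event remains. -/
lemma tendsto_linearModel_zero (hX : ∀ n, (X n).rank = p n) (hXi : ∀ n, (Xi n).rank = i n)
    (hσ : ∀ n, 0 < σ n) {τ : ℝ} (hτ : 0 < τ) {S : ∀ n : ℕ, Set (Fin n → ℝ)}
    (hS : ∀ᶠ n : ℕ in atTop, ∀ y : Fin n → ℝ,
      |residualSS (X n) y / (n * σ n ^ 2) - ((n : ℝ) - p n) / n| ≤ τ →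
      |residualSS (Xi n) y / (n * σ n ^ 2) -
        (((n : ℝ) - i n) / n + modelDistance (Xi n) (X n) (β n) (σ n))| ≤
          τ * (1 + modelDistance (Xi n) (X n) (β n) (σ n)) → y ∉ S n) :
    Tendsto (fun n => linearModel (X n) (β n) (σ n) (S n)) atTop (𝓝 0) := by
  have hlim : Tendsto (fun n : ℕ => ENNReal.ofReal ((4 * sqVariance + 16) / (n * τ ^ 2)))
      atTop (𝓝 0) := by
    rw [← ENNReal.ofReal_zero]
    refine ENNReal.tendsto_ofReal (tendsto_const_nhds.div_atTop ?_)
    exact tendsto_natCast_atTop_atTop.atTop_mul_const (by positivity)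
  have hlim2 := hlim.add hlim
  rw [add_zero] at hlim2
  refine tendsto_of_tendsto_of_tendsto_of_le_of_le' tendsto_const_nhds hlim2
    (Eventually.of_forall fun n => zero_le) ?_
  filter_upwards [hS, eventually_gt_atTop 0] with n hn hn0
  refine le_trans (measure_mono fun y hy => ?_)
    (linearModel_tail_residualSS (hX n) (hXi n) (β n) (hσ n) hτ hn0)
  exact fun hgood => hn y hgood.1 hgood.2 hy

lemma tendsto_sub_div (hp : Tendsto (fun n : ℕ => (n : ℝ) / (p n : ℝ)) atTop (𝓝 r))
    (hr : 1 < r) : Tendsto (fun n : ℕ => ((n : ℝ) - p n) / n) atTop (𝓝 (1 - r⁻¹)) := by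
  refine ((tendsto_inv_ratio hp hr).const_sub 1).congr' ?_
  filter_upwards [eventually_gt_atTop 0] with n hn
  have hn' : (n : ℝ) ≠ 0 := by positivity
  rw [one_sub_div hn']

lemma tendstoInProbAtTop_of_boundaryDelta_lt (hr : 1 < r) (hrs : r < s)
    (hX : ∀ n, (X n).rank = p n) (hXi : ∀ n, (Xi n).rank = i n)
    (hp : Tendsto (fun n : ℕ => (n : ℝ) / (p n : ℝ)) atTop (𝓝 r))
    (hi : Tendsto (fun n : ℕ => (n : ℝ) / (i n : ℝ)) atTop (𝓝 s))
    (hσ : ∀ n, 0 < σ n) {δ₀ : ℝ} (hδ₀ : boundaryDelta r s < δ₀)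
    (hδ : ∀ᶠ n in atTop, δ₀ ≤ modelDistance (Xi n) (X n) (β n) (σ n)) :
    TendstoInProbAtTop (fun n => linearModel (X n) (β n) (σ n))
      (fun n => intrinsicBayesFactor (Xi n) (X n)) := by
  intro K
  have hs := hr.trans hrs
  have hcr := criticalRatio_pos hr hrs
  have hD : 0 < 1 - r⁻¹ := sub_pos.2 (inv_lt_one_of_one_lt₀ hr)
  have hE : 0 < 1 - s⁻¹ := sub_pos.2 (inv_lt_one_of_one_lt₀ hs)
  have hδ₀p : 0 < δ₀ := (boundaryDelta_pos hr hrs).trans hδ₀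
  have h1 : (1 - r⁻¹) / (1 - s⁻¹ + δ₀) < criticalRatio r s := by
    rw [boundaryDelta_eq_criticalRatio hr hrs, sub_lt_iff_lt_add, div_lt_iff₀ hcr] at hδ₀
    rw [div_lt_iff₀ (by linarith)]
    linarith
  obtain ⟨b, hb1, hb2⟩ := exists_between h1
  have hb0 : 0 < b := lt_trans (by positivity) hb1
  rw [div_lt_iff₀ (by linarith)] at hb1
  -- The last inequality is strict at `τ = 0`, hence persists for small `τ > 0` by continuity.
  obtain ⟨τ, hτ, hτ1, hτ2, hτ3⟩ : ∃ τ : ℝ, 0 < τ ∧ τ < 1 - r⁻¹ ∧ τ < 1 ∧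
      1 - r⁻¹ + τ < b * (1 - s⁻¹ - τ + (1 - τ) * δ₀) := by
    have hc : ContinuousAt (fun τ : ℝ => b * (1 - s⁻¹ - τ + (1 - τ) * δ₀) - (1 - r⁻¹ + τ)) 0 := by
      fun_prop
    have hev := (hc.eventually (lt_mem_nhds (a := 0) (by simp only; linarith))).filter_mono
      (nhdsWithin_le_nhds (s := Set.Ioi 0))
    obtain ⟨τ, h, h'⟩ := (hev.and (Ioo_mem_nhdsGT (lt_min hD one_pos))).exists
    exact ⟨τ, h'.1, h'.2.trans_le (min_le_left _ _), h'.2.trans_le (min_le_right _ _),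
      by linarith⟩
  refine tendsto_linearModel_zero hX hXi hσ hτ ?_
  have hDn := tendsto_sub_div hp hr
  have hEn := tendsto_sub_div hi hs
  filter_upwards [eventually_gt_atTop 0, hδ, hDn.eventually (lt_mem_nhds hτ1),
    (hDn.add_const τ).eventually_lt
      (((hEn.sub_const τ).add_const ((1 - τ) * δ₀)).const_mul b) hτ3,
    eventually_lt_bayesFactorOfRatio hp hi hr hrs hb2 K] with n hn hδn hD1 hD2 hbf y hy1 hy2 hyS
  have hn' : (0 : ℝ) < n := by exact_mod_cast hn
  have hσn := hσ n
  refine absurd (hyS : intrinsicBayesFactor (Xi n) (X n) y ≤ K) (not_le.2 ?_)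
  rw [intrinsicBayesFactor_eq,
    rssRatio_eq_normalized _ _ _ (show (n : ℝ) * σ n ^ 2 ≠ 0 by positivity)]
  obtain ⟨hy1a, hy1b⟩ := abs_le.1 hy1
  obtain ⟨hy2a, hy2b⟩ := abs_le.1 hy2
  have hRp : 0 < residualSS (X n) y / (n * σ n ^ 2) := by linarith
  -- The error `τ (1 + δ_n)` is absorbed into `δ_n` before `δ₀ ≤ δ_n` is used; `τ < 1` keeps the
  -- coefficient nonnegative, so no upper bound on `δ_n` is needed.
  have hmono : (1 - τ) * δ₀ ≤ (1 - τ) * modelDistance (Xi n) (X n) (β n) (σ n) :=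
    mul_le_mul_of_nonneg_left hδn (by linarith)
  have hRi : ((n : ℝ) - i n) / n - τ + (1 - τ) * δ₀ ≤ residualSS (Xi n) y / (n * σ n ^ 2) := by
    linarith
  have hbRi := mul_le_mul_of_nonneg_left hRi hb0.le
  have hRi0 : 0 < residualSS (Xi n) y / (n * σ n ^ 2) :=
    pos_of_mul_pos_right (a := b) (by linarith) hb0.le
  refine hbf _ (div_pos hRp hRi0) ?_
  rw [div_le_iff₀ hRi0]
  linarith

lemma tendstoInProb_zero_of_lt_boundaryDelta (hr : 1 < r) (hrs : r < s)
    (hX : ∀ n, (X n).rank = p n) (hXi : ∀ n, (Xi n).rank = i n)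
    (hp : Tendsto (fun n : ℕ => (n : ℝ) / (p n : ℝ)) atTop (𝓝 r))
    (hi : Tendsto (fun n : ℕ => (n : ℝ) / (i n : ℝ)) atTop (𝓝 s))
    (hσ : ∀ n, 0 < σ n) {δ₁ : ℝ} (hδ₁ : δ₁ < boundaryDelta r s)
    (hδ : ∀ᶠ n in atTop, modelDistance (Xi n) (X n) (β n) (σ n) ≤ δ₁) :
    TendstoInProb (fun n => linearModel (X n) (β n) (σ n))
      (fun n => intrinsicBayesFactor (Xi n) (X n)) 0 := by
  intro ε hε
  have hs := hr.trans hrs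
  have hcr := criticalRatio_pos hr hrs
  have hE : 0 < 1 - s⁻¹ := sub_pos.2 (inv_lt_one_of_one_lt₀ hs)
  have hnn : ∀ n, 0 ≤ modelDistance (Xi n) (X n) (β n) (σ n) :=
    fun n => modelDistance_nonneg (hXi n) _ _
  have hδ₁0 : 0 ≤ δ₁ := by
    obtain ⟨n, hn⟩ := hδ.exists
    exact (hnn n).trans hn
  have h1 : criticalRatio r s < (1 - r⁻¹) / (1 - s⁻¹ + δ₁) := by
    rw [boundaryDelta_eq_criticalRatio hr hrs, lt_sub_iff_add_lt, lt_div_iff₀ hcr] at hδ₁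
    rw [lt_div_iff₀ (by linarith)]
    linarith
  obtain ⟨b, hb1, hb2⟩ := exists_between h1
  have hb0 : 0 < b := hcr.trans hb1
  rw [lt_div_iff₀ (by linarith)] at hb2
  obtain ⟨τ, hτ, hτ1, hτ2, hτ3⟩ : ∃ τ : ℝ, 0 < τ ∧ τ < 1 - s⁻¹ ∧ τ < 1 ∧
      b * (1 - s⁻¹ + τ + (1 + τ) * δ₁) < 1 - r⁻¹ - τ := by
    have hc : ContinuousAt (fun τ : ℝ => 1 - r⁻¹ - τ - b * (1 - s⁻¹ + τ + (1 + τ) * δ₁)) 0 := by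
      fun_prop
    have hev := (hc.eventually (lt_mem_nhds (a := 0) (by simp only; linarith))).filter_mono
      (nhdsWithin_le_nhds (s := Set.Ioi 0))
    obtain ⟨τ, h, h'⟩ := (hev.and (Ioo_mem_nhdsGT (lt_min hE one_pos))).exists
    exact ⟨τ, h'.1, h'.2.trans_le (min_le_left _ _), h'.2.trans_le (min_le_right _ _),
      by linarith⟩
  refine tendsto_linearModel_zero hX hXi hσ hτ ?_
  have hDn := tendsto_sub_div hp hr
  have hEn := tendsto_sub_div hi hs
  filter_upwards [eventually_gt_atTop 0, hδ, hEn.eventually (lt_mem_nhds hτ1),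
    (((hEn.add_const τ).add_const ((1 + τ) * δ₁)).const_mul b).eventually_lt
      (hDn.sub_const τ) hτ3,
    eventually_abs_bayesFactorOfRatio_lt hp hi hr hrs hb1 hε] with n hn hδn hE1 hE2 hbf y hy1 hy2 hyS
  have hn' : (0 : ℝ) < n := by exact_mod_cast hn
  have hσn := hσ n
  refine absurd (hyS : ε ≤ |intrinsicBayesFactor (Xi n) (X n) y - 0|) (not_le.2 ?_)
  rw [sub_zero, intrinsicBayesFactor_eq,
    rssRatio_eq_normalized _ _ _ (show (n : ℝ) * σ n ^ 2 ≠ 0 by positivity)]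
  obtain ⟨hy1a, hy1b⟩ := abs_le.1 hy1
  obtain ⟨hy2a, hy2b⟩ := abs_le.1 hy2
  have hmono0 : 0 ≤ (1 - τ) * modelDistance (Xi n) (X n) (β n) (σ n) :=
    mul_nonneg (by linarith) (hnn n)
  have hmono : (1 + τ) * modelDistance (Xi n) (X n) (β n) (σ n) ≤ (1 + τ) * δ₁ :=
    mul_le_mul_of_nonneg_left hδn (by linarith)
  have hRi0 : 0 < residualSS (Xi n) y / (n * σ n ^ 2) := by linarith
  have hRi : residualSS (Xi n) y / (n * σ n ^ 2) ≤ ((n : ℝ) - i n) / n + τ + (1 + τ) * δ₁ := by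
    linarith
  have hbRi := mul_le_mul_of_nonneg_left hRi hb0.le
  refine hbf _ ?_
  rw [le_div_iff₀ hRi0]
  linarith

end FullModel

/-! ### The reduced model inside the full model, and the conclusion -/

lemma mulVec_extend_embedding {n i p : ℕ} (X : Matrix (Fin n) (Fin p) ℝ) (e : Fin i ↪ Fin p)
    (a : Fin i → ℝ) : X *ᵥ Function.extend e a 0 = X.submatrix id e *ᵥ a := by
  ext j
  simp only [Matrix.mulVec, dotProduct, Matrix.submatrix_apply, id]
  refine (Fintype.sum_of_injective e e.injective _ _ (fun k hk => ?_) (fun k => ?_)).symm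
  · rw [Function.extend_apply' _ _ _ (by simpa using hk)]
    simp
  · rw [e.injective.extend_apply]

lemma linearModel_extend_embedding {n i p : ℕ} (X : Matrix (Fin n) (Fin p) ℝ) (e : Fin i ↪ Fin p)
    (a : Fin i → ℝ) (σ : ℝ) :
    linearModel (X.submatrix id e) a σ = linearModel X (Function.extend e a 0) σ := by
  rw [linearModel, linearModel, mulVec_extend_embedding]

lemma modelDistance_extend_embedding {n i p : ℕ} {X : Matrix (Fin n) (Fin p) ℝ}
    (e : Fin i ↪ Fin p) (hXi : (X.submatrix id e).rank = i) (a : Fin i → ℝ) (σ : ℝ) :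
    modelDistance (X.submatrix id e) X (Function.extend e a 0) σ = 0 := by
  rw [modelDistance_eq, mulVec_extend_embedding, one_sub_hatMatrix_mulVec hXi, dotProduct_zero,
    zero_div]

theorem theorem3 :
    -- limits of the Bayes factor under the two sampling models
    (∀ (r s : ℝ), 1 < r → r < s →
      ∀ (i p : ℕ → ℕ)
        (X : ∀ n : ℕ, Matrix (Fin n) (Fin (p n)) ℝ)
        (e : ∀ n : ℕ, Fin (i n) ↪ Fin (p n)),
      (∀ n, (X n).rank = p n) →
      Tendsto (fun n : ℕ => (n : ℝ) / (p n : ℝ)) atTop (𝓝 r) →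
      Tendsto (fun n : ℕ => (n : ℝ) / (i n : ℝ)) atTop (𝓝 s) →
      -- sampling from the reduced model
      (∀ (α : ∀ n : ℕ, Fin (i n) → ℝ) (σ : ℕ → ℝ), (∀ n, 0 < σ n) →
        TendstoInProb (fun n => linearModel ((X n).submatrix id (e n)) (α n) (σ n))
          (fun n => intrinsicBayesFactor ((X n).submatrix id (e n)) (X n)) 0) ∧
      -- sampling from the full model
      (∀ (β : ∀ n : ℕ, Fin (p n) → ℝ) (σ : ℕ → ℝ), (∀ n, 0 < σ n) →
        ∀ δ : EReal,
        Tendsto (fun n : ℕ =>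
            ((modelDistance ((X n).submatrix id (e n)) (X n) (β n) (σ n) : ℝ) : EReal))
          atTop (𝓝 δ) →
        ((boundaryDelta r s : EReal) < δ →
          TendstoInProbAtTop (fun n => linearModel (X n) (β n) (σ n))
            (fun n => intrinsicBayesFactor ((X n).submatrix id (e n)) (X n))) ∧
        (δ < (boundaryDelta r s : EReal) →
          TendstoInProb (fun n => linearModel (X n) (β n) (σ n))
            (fun n => intrinsicBayesFactor ((X n).submatrix id (e n)) (X n)) 0))) ∧
    -- properties of the boundary function on `1 < r < s`
    (∀ r s : ℝ, 1 < r → r < s →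
      0 ≤ boundaryDelta r s ∧ boundaryDelta r s ≤ 1 / Real.log 2 - 1) ∧
    (∀ s : ℝ, 1 < s →
      StrictAntiOn (fun r => boundaryDelta r s) (Set.Ioo 1 s) ∧
      ConvexOn ℝ (Set.Ioo 1 s) (fun r => boundaryDelta r s)) ∧
    (∀ ε : ℝ, 0 < ε → ∃ R : ℝ, 1 < R ∧ ∀ r s : ℝ, R < r → r < s →
      |boundaryDelta r s| < ε) ∧
    (∀ r : ℝ, 1 < r →
      Tendsto (fun s => boundaryDelta r s) atTop (𝓝 (boundaryDeltaLim r))) := by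
  refine ⟨fun r s hr hrs i p X e hX hp hi => ?_, fun r s hr hrs => ?_, fun s hs => ?_,
    boundaryDelta_uniform_limit, fun r hr => tendsto_boundaryDelta_atTop hr⟩
  · have hXi : ∀ n, ((X n).submatrix id (e n)).rank = i n :=
      fun n => rank_submatrix_embedding (hX n) (e n)
    refine ⟨fun α σ hσ => ?_, fun β σ hσ δ hδ => ⟨fun hlt => ?_, fun hlt => ?_⟩⟩
    · simp_rw [linearModel_extend_embedding]
      exact tendstoInProb_zero_of_lt_boundaryDelta hr hrs hX hXi hp hi hσ
        (boundaryDelta_pos hr hrs)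
        (Eventually.of_forall fun n => (modelDistance_extend_embedding (e n) (hXi n) _ _).le)
    -- A real number strictly between the boundary and the extended limit also covers the limit `∞`.
    · obtain ⟨δ₀, h1, h2⟩ := EReal.exists_between_coe_real hlt
      refine tendstoInProbAtTop_of_boundaryDelta_lt hr hrs hX hXi hp hi hσ
        (EReal.coe_lt_coe_iff.1 h1) ?_
      filter_upwards [hδ.eventually (lt_mem_nhds h2)] with n hn
      exact (EReal.coe_lt_coe_iff.1 hn).le
    · obtain ⟨δ₁, h1, h2⟩ := EReal.exists_between_coe_real hlt
      refine tendstoInProb_zero_of_lt_boundaryDelta hr hrs hX hXi hp hi hσ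
        (EReal.coe_lt_coe_iff.1 h2) ?_
      filter_upwards [hδ.eventually (gt_mem_nhds h1)] with n hn
      exact (EReal.coe_lt_coe_iff.1 hn).le
  · exact ⟨(boundaryDelta_pos hr hrs).le, (boundaryDelta_le_powerQuot hr hrs).trans
      (sub_le_sub_right (powerQuot_le_one_div_log_two hr) 1)⟩
  · exact ⟨boundaryDelta_strictAntiOn hs, boundaryDelta_convexOn hs⟩
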